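/- Consider four bosonic modes $a,b,c,z$ with annihilation operators $\hat a,\hat b,\hat c,\hat z$ and quadratures $\hat x_j=(\hat a_j+\hat a_j^\dagger)/\sqrt2$, $\hat p_j=-i(\hat a_j-\hat a_j^\dagger)/\sqrt2$, where $\hat a_j$ denotes the annihilation operator of mode $j$. A tripartite state of the modes $a,b,c$ is called $1|23$ (respectively $2|13$, $3|12$) separable if it is a finite or countable mixture of products of a state of $a$ (respectively $b$, $c$) with a joint state of the other two modes; it is biseparable if it is a mixture of $1|23$, $2|13$ and $3|12$ separable states, and fully separable if it is a mixture of products of three one-mode states. Consider four-mode states $$\hat\varrho'=\sum_i p_i\,\hat\varrho_{abc,i}\otimes\hat\varrho_{z,i},\qquad p_i\ge0,\quad \sum_i p_i=1,$$ so that the auxiliary mode $z$ is separable from the other three. Expectation values $\langle \hat M\hat M^\dagger\rangle$ are taken in the state $\hat\varrho'$ and in $[0,\infty]$ (no finiteness of moments is assumed). Put $$T'^{(1)}_3=3\langle(\hat x_a+\hat x_b+\hat x_c+\hat x_z)^2\rangle+\langle(\hat p_a-\hat p_b-\hat p_c+\hat p_z)^2\rangle+\langle(-\hat p_a+\hat p_b-\hat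 p_c+\hat p_z)^2\rangle+\langle(-\hat p_a-\hat p_b+\hat p_c+\hat p_z)^2\rangle$$ and, for $m\ge0$, $$\mathcal A'^{(m)}_{1|23}=\frac1{m!}\big\langle(\hat a^\dagger+\hat b+\hat c+\hat z^\dagger)^m(\hat a+\hat b^\dagger+\hat c^\dagger+\hat z)^m\big\rangle,$$ with $\mathcal A'^{(m)}_{2|13}$ and $\mathcal A'^{(m)}_{3|12}$ obtained by letting $\hat b$, respectively $\hat c$, take the role of $\hat a$. Then: 1. $T'^{(1)}_3-3\ge 9$ if all $\hat\varrho_{abc,i}$ are fully separable, $T'^{(1)}_3-3\ge5$ if all $\hat\varrho_{abc,i}$ are biseparable, and $T'^{(1)}_3-3\ge3$ for arbitrary $\hat\varrho_{abc,i}$. 2. The four linear combinations of quadratures whose second moments enter $T'^{(1)}_3$ commute pairwise (on the finite linear combinations of number states). 3. For every $m\ge0$, $\mathcal A'^{(m)}_{1|23}\ge2^m$ if all $\hat\varrho_{abc,i}$ are $1|23$ separable, and $\mathcal A'^{(m)}_{1|23}\ge1$ for arbitrary $\hat\varrho_{abc,i}$; likewise for $\mathcal A'^{(m)}_{2|13}$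 with $2|13$ separability and for $\mathcal A'^{(m)}_{3|12}$ with $3|12$ separability. -/

import Mathlib

open scoped InnerProductSpace ENNReal

noncomputable section

/-- The Hilbert space of `d` bosonic modes, `ℓ²(ℕ^d)`, written in the Fock (number) basis. -/
abbrev Fock (d : ℕ) : Type := lp (fun _ : Fin d → ℕ => ℂ) 2

/-- The number state `|n₀, …, n_{d-1}⟩`. -/
def ket {d : ℕ} (n : Fin d → ℕ) : Fock d := lp.single 2 n (1 : ℂ)

/-- Density operators of `d` modes: positive operators of trace one. -/
structure DensityOperator (d : ℕ) where
  op : Fock d →L[ℂ] Fock d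
  isPositive : op.IsPositive
  hasSum_trace : HasSum (fun n => ⟪ket n, op (ket n)⟫_ℂ) 1

/-- The matrix element `⟨n| ρ |m⟩`. -/
def DensityOperator.elem {d : ℕ} (ρ : DensityOperator d) (n m : Fin d → ℕ) : ℂ :=
  ⟪ket n, ρ.op (ket m)⟫_ℂ

/-! ### Separability -/

/-- `ρ = ∑ᵢ pᵢ σᵢ` for states `σᵢ` in `S` and probabilities `pᵢ` (finitely or countably many). -/
def IsMixture {d : ℕ} (S : Set (DensityOperator d)) (ρ : DensityOperator d) : Prop :=
  ∃ (p : ℕ → ℝ) (σ : ℕ → DensityOperator d),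
    (∀ i, 0 ≤ p i) ∧ HasSum p 1 ∧ (∀ i, σ i ∈ S) ∧
      HasSum (fun i => (p i : ℂ) • (σ i).op) ρ.op

/-- `ρ = σ ⊗ τ`, where the modes of `σ` are placed at the positions `f` of the composite system and
those of `τ` at the positions `g`; it is used only where `f` and `g` are injective with
complementary ranges. -/
def IsTensor {d k l : ℕ} (f : Fin k → Fin d) (g : Fin l → Fin d)
    (ρ : DensityOperator d) (σ : DensityOperator k) (τ : DensityOperator l) : Prop :=
  ∀ n m : Fin d → ℕ, ρ.elem n m = σ.elem (n ∘ f) (m ∘ f) * τ.elem (n ∘ g) (m ∘ g)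

/-- Tripartite states that are separable in the bipartition `s | rest`: mixtures of products of a
one-mode state of part `s` and a joint state of the two other parts. -/
def PartiallySeparable (s : Fin 3) : Set (DensityOperator 3) :=
  {ρ | IsMixture {ρ' | ∃ (σ : DensityOperator 1) (τ : DensityOperator 2),
    IsTensor (fun _ => s) s.succAbove ρ' σ τ} ρ}

/-- Biseparable tripartite states: mixtures of `1|23`, `2|13` and `3|12` separable states. -/
def Biseparable : Set (DensityOperator 3) :=
  {ρ | IsMixture (⋃ s, PartiallySeparable s) ρ}

/-- Fully separable tripartite states: mixtures of products of three one-mode states. -/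
def FullySeparable : Set (DensityOperator 3) :=
  {ρ | IsMixture {ρ' | ∃ σ : Fin 3 → DensityOperator 1,
    ∀ n m : Fin 3 → ℕ, ρ'.elem n m = ∏ i, (σ i).elem (fun _ => n i) (fun _ => m i)} ρ}

/-- Four-mode states `∑ᵢ pᵢ ρ_{abc,i} ⊗ ρ_{z,i}` in which the fourth mode `z` is separable from the
first three, and every `ρ_{abc,i}` belongs to the class `C` of tripartite states. -/
def Augmented (C : Set (DensityOperator 3)) : Set (DensityOperator 4) :=
  {ρ | IsMixture {ρ' | ∃ σ ∈ C, ∃ τ : DensityOperator 1,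
    IsTensor Fin.castSucc (fun _ => Fin.last 3) ρ' σ τ} ρ}

/-! ### Mode operators -/

/-- The dense domain of finite linear combinations of number states. -/
abbrev FiniteFock (d : ℕ) : Type := (Fin d → ℕ) →₀ ℂ

/-- Operators on the common invariant domain `FiniteFock d`; products are compositions. -/
abbrev ModeOp (d : ℕ) : Type := Module.End ℂ (FiniteFock d)

/-- The inclusion of the finite linear combinations of number states into the Hilbert space. -/
def toFock {d : ℕ} : FiniteFock d →ₗ[ℂ] Fock d := Finsupp.linearCombination ℂ ket

/-- The annihilation operator of mode `j`: `|n⟩ ↦ √n_j |n - e_j⟩`. -/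
def annihilate {d : ℕ} (j : Fin d) : ModeOp d :=
  Finsupp.linearCombination ℂ fun n : Fin d → ℕ =>
    Finsupp.single (n - Pi.single j 1) ((√(n j : ℝ) : ℝ) : ℂ)

/-- The creation operator of mode `j`: `|n⟩ ↦ √(n_j + 1) |n + e_j⟩`. -/
def create {d : ℕ} (j : Fin d) : ModeOp d :=
  Finsupp.linearCombination ℂ fun n : Fin d → ℕ =>
    Finsupp.single (n + Pi.single j 1) ((√((n j : ℝ) + 1) : ℝ) : ℂ)

/-- The position operator `x = (a + a†) / √2` of mode `j`. -/
def position {d : ℕ} (j : Fin d) : ModeOp d :=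
  (((√2 : ℝ) : ℂ)⁻¹) • (annihilate j + create j)

/-- The momentum operator `p = -i (a - a†) / √2` of mode `j`. -/
def momentum {d : ℕ} (j : Fin d) : ModeOp d :=
  (-Complex.I * ((√2 : ℝ) : ℂ)⁻¹) • (annihilate j - create j)

/-- The expectation value `⟨M M†⟩ = Tr (M† ρ M) = ∑ₙ ⟨M n| ρ |M n⟩` of the positive, in general
unbounded operator `M M†` in the state `ρ`, as an element of `[0, ∞]`. For symmetric `M` this is the
second moment `⟨M²⟩`. If `ρ = ∑ᵢ pᵢ |ψᵢ⟩⟨ψᵢ|`, its value is `∑ᵢ pᵢ ‖M† ψᵢ‖²`, where `M†` is the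
Hilbert space adjoint of `M` and `‖M† ψᵢ‖ = ∞` off the domain of `M†`. -/
def meanMulAdjoint {d : ℕ} (ρ : DensityOperator d) (M : ModeOp d) : ℝ≥0∞ :=
  ∑' n : Fin d → ℕ, ENNReal.ofReal
    (RCLike.re ⟪toFock (M (Finsupp.single n 1)), ρ.op (toFock (M (Finsupp.single n 1)))⟫_ℂ)

/-! ### The augmented quantities; the modes `a, b, c, z` are `0, 1, 2, 3` -/

/-- The four observables that enter `T'`. -/
def augmentedObservable : Fin 4 → ModeOp 4 :=
  ![position 0 + position 1 + position 2 + position 3,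
    momentum 0 - momentum 1 - momentum 2 + momentum 3,
    -momentum 0 + momentum 1 - momentum 2 + momentum 3,
    -momentum 0 - momentum 1 + momentum 2 + momentum 3]

/-- `T' = 3⟨(x_a + x_b + x_c + x_z)²⟩ + ⟨(p_a - p_b - p_c + p_z)²⟩ + ⟨(-p_a + p_b - p_c + p_z)²⟩
+ ⟨(-p_a - p_b + p_c + p_z)²⟩`. -/
def augmentedT (ρ : DensityOperator 4) : ℝ≥0∞ :=
  3 * meanMulAdjoint ρ (augmentedObservable 0) + meanMulAdjoint ρ (augmentedObservable 1)
    + meanMulAdjoint ρ (augmentedObservable 2) + meanMulAdjoint ρ (augmentedObservable 3)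

/-- `(1 / m!) ⟨(a† + b + c + z†)^m (a + b† + c† + z)^m⟩` for `s = 0`; for `s = 1, 2` the part `s`
takes the role of `a`. The second factor is the adjoint of the first. -/
def augmentedA (m : ℕ) (s : Fin 3) (ρ : DensityOperator 4) : ℝ≥0∞ :=
  (m.factorial : ℝ≥0∞)⁻¹ * meanMulAdjoint ρ
    ((create s.castSucc + annihilate (s.succAbove 0).castSucc
      + annihilate (s.succAbove 1).castSucc + create (Fin.last 3)) ^ m)

end

/-! ### Normal ordering of polynomials in an operator with scalar commutator. -/

section NormalOrdering

open Polynomial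

variable {E H : Type*} [AddCommGroup E] [Module ℂ E] [NormedAddCommGroup H]
  [InnerProductSpace ℂ H]

/-! The matrix elements of a separable state form a kernel `∑ₖ conj (uₖ n) * uₖ m` in which every
`uₖ` (a conjugated, unnormalized pure state) is a product across the relevant cut. Transposing `M`
onto `uₖ` turns `⟨M M†⟩` into `∑ₖ ‖Mᵀ uₖ‖²` in `[0, ∞]` (`IsGram.exists_mean_eq_tsum`). The
transposed ladder operators act on arbitrary coefficient families, so no domain question arises, and
it suffices to bound a single product.

Let `D` be linear in the ladder operators and `u = φ χ`, with `φ` living on the modes in `G`. Split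
`D` into its part `D_G` on `G` and the rest. Once the occupations outside `G` are fixed, `D^m u`
equals `P(D_G) φ` with `deg P ≤ m` and coefficient `χ` at `m` (`exists_ladder_pow_eq_aeval`). If
`[D_G†, D_G] = κ > 0`, then `P(D_G)† P(D_G)` is the sum over `j` of the positive operators `κ^j / j!
· P⁽ʲ⁾(D_G) P⁽ʲ⁾(D_G)†`, and `j = m` alone gives `m! κ^m |χ|²`. Summing over the slices yields `‖D^m
u‖² ≥ m! κ^m ‖u‖²` (`Splits.tsum_ladder_pow_ge`), whatever `D` does outside `G`. The algebra is
carried out on rapidly decreasing families; square-summable `φ` are reached by damping with `t` to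
the number of quanta and letting `t → 1` from below.

For the higher-order quantities, the two modes other than `s` and `z` give `κ = 2` when `{s, z}` is
a side of the cut; in general `{a, b, c}` gives `κ = 1`. In `T'`, the weight 3 provides one copy of
`X²` for each momentum combination `P_s`, and `2 (‖X u‖² + ‖P_s u‖²) = ‖(X + i P_s) u‖² + ‖(X - i
P_s) u‖²`. The two operators have opposite commutators, so one is bounded on each side of the cut,
with the same `κ`: 4 for the cut `{s, z}`, 2 for the cut `{z}`. The totals are 12, 8 and 6. -/

theorem mul_aeval_eq_of_commutator {A B : Module.End ℂ E} {κ : ℂ} (h : B * A = A * B + κ • 1)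
    (Q : ℂ[X]) : B * aeval A Q = aeval A Q * B + κ • aeval A (derivative Q) := by
  induction Q using Polynomial.induction_on with
  | C a => simp [Algebra.algebraMap_eq_smul_one]
  | add P Q hP hQ => simp only [map_add, mul_add, add_mul, hP, hQ, smul_add]; abel
  | monomial n a ih =>
    rw [pow_succ, ← mul_assoc, map_mul, aeval_X, ← mul_assoc, ih, add_mul, mul_assoc, h,
      derivative_mul (g := X), derivative_X, mul_one, map_add, map_mul (aeval A) (derivative _),
      aeval_X, mul_add, smul_add, smul_mul_assoc, mul_smul_comm, mul_one, mul_assoc]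
    abel

theorem inner_aeval_left {J : E →ₗ[ℂ] H} {A B : Module.End ℂ E}
    (hadj : ∀ x y, ⟪J (A x), J y⟫_ℂ = ⟪J x, J (B y)⟫_ℂ) (P : ℂ[X]) (x y : E) :
    ⟪J (aeval A P x), J y⟫_ℂ = ⟪J x, J (aeval B (P.map (starRingEnd ℂ)) y)⟫_ℂ := by
  induction P using Polynomial.induction_on generalizing y with
  | C a => simp [Algebra.algebraMap_eq_smul_one, mul_comm]
  | add P Q hP hQ => simp [hP, hQ]
  | monomial n a ih =>
    rw [pow_succ, ← mul_assoc, mul_comm, map_mul, aeval_X, Module.End.mul_apply, hadj, ih,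
      Polynomial.map_mul (p := X), map_X, mul_comm X (Polynomial.map _ _), map_mul, aeval_X, Module.End.mul_apply]

theorem inner_aeval_right {J : E →ₗ[ℂ] H} {A B : Module.End ℂ E}
    (hadj : ∀ x y, ⟪J (A x), J y⟫_ℂ = ⟪J x, J (B y)⟫_ℂ) (Q : ℂ[X]) (x y : E) :
    ⟪J x, J (aeval A Q y)⟫_ℂ = ⟪J (aeval B (Q.map (starRingEnd ℂ)) x), J y⟫_ℂ := by
  rw [← inner_conj_symm, inner_aeval_left hadj, inner_conj_symm]

/-- Normal ordering of `P(A)† Q(A)` for `A† = B` and `[B, A] = κ`. -/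
theorem exists_inner_aeval_eq_sum {J : E →ₗ[ℂ] H} {A B : Module.End ℂ E} {κ : ℂ}
    (hadj : ∀ x y, ⟪J (A x), J y⟫_ℂ = ⟪J x, J (B y)⟫_ℂ) (h : B * A = A * B + κ • 1)
    (P : ℂ[X]) : ∃ N₀ : ℕ, ∀ N ≥ N₀, ∀ (Q : ℂ[X]) (x y : E),
      ⟪J (aeval A P x), J (aeval A Q y)⟫_ℂ = ∑ j ∈ Finset.range N, (κ ^ j / (j.factorial : ℂ)) *
        ⟪J (aeval B ((derivative^[j] Q).map (starRingEnd ℂ)) x),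
          J (aeval B ((derivative^[j] P).map (starRingEnd ℂ)) y)⟫_ℂ := by
  induction P using Polynomial.induction_on with
  | C a =>
    refine ⟨1, fun N hN Q x y => ?_⟩
    obtain ⟨N, rfl⟩ := Nat.exists_eq_add_of_le' hN
    -- Only `j = 0` survives, since all derivatives of a constant vanish.
    rw [Finset.sum_range_succ', Finset.sum_eq_zero]
    · simp [Algebra.algebraMap_eq_smul_one,
        inner_aeval_right hadj, mul_comm]
    · intro j _
      simp [Function.iterate_succ_apply]
  | add P Q hP hQ =>
    obtain ⟨N₁, h₁⟩ := hP
    obtain ⟨N₂, h₂⟩ := hQ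
    refine ⟨max N₁ N₂, fun N hN R x y => ?_⟩
    simp only [map_add, LinearMap.add_apply, inner_add_left, h₁ N (le_of_max_le_left hN),
      h₂ N (le_of_max_le_right hN), iterate_map_add, Polynomial.map_add, inner_add_right,
      mul_add, Finset.sum_add_distrib]
  | monomial n a ih =>
    obtain ⟨N₀, h₀⟩ := ih
    -- The commutator term is expanded to length `N` and then shifted by one index, hence the extra
    -- one.
    refine ⟨N₀ + 1, fun N hN Q x y => ?_⟩
    obtain ⟨N, rfl⟩ := Nat.exists_eq_add_of_le' (Nat.one_le_of_lt hN)
    have hPX : C a * X ^ (n + 1) = X * (C a * X ^ n) := by ring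
    have key : ∀ z, B (aeval A Q z) = aeval A Q (B z) + κ • aeval A (derivative Q) z := fun z => by
      simpa using LinearMap.congr_fun (mul_aeval_eq_of_commutator h Q) z
    rw [hPX, map_mul, aeval_X, Module.End.mul_apply, hadj, key, map_add, inner_add_right, map_smul,
      inner_smul_right, h₀ (N + 1) (by omega), h₀ N (by omega)]
    generalize C a * X ^ n = P
    -- By Leibniz, the first summand matches the term in which `B` has passed through `Q(A)`. The
    -- second, reindexed by `j ↦ j + 1`, matches the commutator term with `Q'`.
    have hd : ∀ j, derivative^[j] (X * P) = X * derivative^[j] P + j • derivative^[j - 1] P :=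
      fun j => by rw [mul_comm, iterate_derivative_mul_X, mul_comm]
    simp only [hd, Polynomial.map_add, map_add, Polynomial.map_mul, map_X, LinearMap.add_apply,
      inner_add_right, mul_add, Finset.sum_add_distrib]
    congr 1
    · refine Finset.sum_congr rfl fun j _ => ?_
      rw [mul_comm X, map_mul, aeval_X, Module.End.mul_apply]
    · rw [Finset.sum_range_succ']
      simp only [zero_smul, Polynomial.map_zero, map_zero, LinearMap.zero_apply, inner_zero_right,
        mul_zero, add_zero, Nat.add_sub_cancel, Finset.mul_sum]
      refine Finset.sum_congr rfl fun j _ => ?_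
      rw [← Function.iterate_succ_apply, nsmul_eq_mul, Polynomial.map_mul, map_mul,
        Polynomial.map_natCast, map_natCast, Nat.factorial_succ]
      have : ((j : ℂ) + 1) ≠ 0 := by exact_mod_cast Nat.succ_ne_zero j
      have h2 : ((j.factorial : ℕ) : ℂ) ≠ 0 := by exact_mod_cast Nat.factorial_ne_zero j
      have h3 : ∀ (k : ℕ) (z : E), J (((k : Module.End ℂ E) * aeval B ((derivative^[j] P).map
          (starRingEnd ℂ))) z) = (k : ℂ) • J (aeval B ((derivative^[j] P).map
          (starRingEnd ℂ)) z) := fun k z => by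
        rw [Module.End.mul_apply, Module.End.natCast_apply, map_nsmul, Nat.cast_smul_eq_nsmul]
      rw [h3, inner_smul_right]
      push_cast
      field_simp
      ring_nf

/-- For `Q = P` all terms of the normally ordered sum are nonnegative. The term `j = m` contains the
constant `m! * P.coeff m`, so it contributes `κ^m / m! * (m!)²`. -/
theorem norm_aeval_sq_ge {J : E →ₗ[ℂ] H} {A B : Module.End ℂ E} {κ : ℝ} (hκ : 0 ≤ κ)
    (hadj : ∀ x y, ⟪J (A x), J y⟫_ℂ = ⟪J x, J (B y)⟫_ℂ) (h : B * A = A * B + (κ : ℂ) • 1)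
    {P : ℂ[X]} {m : ℕ} (hP : P.natDegree ≤ m) (x : E) :
    m.factorial * κ ^ m * ‖P.coeff m‖ ^ 2 * ‖J x‖ ^ 2 ≤ ‖J (aeval A P x)‖ ^ 2 := by
  obtain ⟨N₀, h₀⟩ := exists_inner_aeval_eq_sum hadj h P
  have hs := congrArg Complex.re (h₀ (max N₀ (m + 1)) (le_max_left _ _) P x x)
  have hterm : ∀ j : ℕ, (((κ : ℂ) ^ j / (j.factorial : ℂ)) *
        ⟪J (aeval B ((derivative^[j] P).map (starRingEnd ℂ)) x),
          J (aeval B ((derivative^[j] P).map (starRingEnd ℂ)) x)⟫_ℂ).re =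
      κ ^ j / j.factorial * ‖J (aeval B ((derivative^[j] P).map (starRingEnd ℂ)) x)‖ ^ 2 := by
    intro j
    rw [inner_self_eq_norm_sq_to_K]
    norm_cast
    exact Complex.re_ofReal_mul _ _
  rw [inner_self_eq_norm_sq_to_K, Complex.re_sum, Finset.sum_congr rfl fun j _ => hterm j] at hs
  have hl : (((‖J (aeval A P x)‖ : ℝ) : ℂ) ^ 2).re = ‖J (aeval A P x)‖ ^ 2 := by norm_cast
  have hs' := hl.symm.trans hs
  rw [hs']
  refine le_trans (le_of_eq ?_) (Finset.single_le_sum (f := fun j : ℕ => κ ^ j / j.factorial *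
    ‖J (aeval B ((derivative^[j] P).map (starRingEnd ℂ)) x)‖ ^ 2)
    (fun j _ => by positivity) (Finset.mem_range.2 (lt_max_of_lt_right m.lt_succ_self)))
  have hd : derivative^[m] P = C ((m.factorial : ℂ) * P.coeff m) := by
    rw [eq_C_of_natDegree_le_zero (p := derivative^[m] P)
      ((natDegree_iterate_derivative P m).trans (by omega)), coeff_iterate_derivative]
    simp [Nat.descFactorial_self]
  have h2 : ((m.factorial : ℕ) : ℝ) ≠ 0 := by exact_mod_cast Nat.factorial_ne_zero m
  rw [hd, Polynomial.map_C, aeval_C, Algebra.algebraMap_eq_smul_one, LinearMap.smul_apply, map_smul,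
    norm_smul, Module.End.one_apply, RCLike.norm_conj, norm_mul, RCLike.norm_natCast]
  field_simp

end NormalOrdering

/-! ### Ladder operators on arbitrary coefficient families, and damping. -/

noncomputable section Sequences

open Polynomial Filter Topology

theorem LinearMap.comp_aeval_of_comp {M N : Type*} [AddCommGroup M] [Module ℂ M] [AddCommGroup N]
    [Module ℂ N] {f : M →ₗ[ℂ] N} {A : Module.End ℂ M} {B : Module.End ℂ N}
    (h : ∀ x, f (A x) = B (f x)) (P : ℂ[X]) (x : M) : f (aeval A P x) = aeval B P (f x) := by
  induction P using Polynomial.induction_on generalizing x with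
  | C a => simp [Algebra.algebraMap_eq_smul_one]
  | add P Q hP hQ => simp [hP, hQ]
  | monomial n a ih =>
    rw [pow_succ, ← mul_assoc, map_mul (aeval A), map_mul (aeval B), aeval_X, aeval_X,
      Module.End.mul_apply, ih, h, Module.End.mul_apply]

variable {d : ℕ}

/-- The annihilation operator of mode `j` on all families of coefficients. -/
def lowering (j : Fin d) : Module.End ℂ ((Fin d → ℕ) → ℂ) where
  toFun u n := ((√((n j : ℝ) + 1) : ℝ) : ℂ) * u (n + Pi.single j 1)
  map_add' u v := by ext n; simp [mul_add]
  map_smul' c u := by ext n; simp [mul_left_comm]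

/-- The creation operator of mode `j` on all families of coefficients. -/
def raising (j : Fin d) : Module.End ℂ ((Fin d → ℕ) → ℂ) where
  toFun u n := ((√(n j : ℝ) : ℝ) : ℂ) * u (n - Pi.single j 1)
  map_add' u v := by ext n; simp [mul_add]
  map_smul' c u := by ext n; simp [mul_left_comm]

theorem lowering_apply (j : Fin d) (u : (Fin d → ℕ) → ℂ) (n : Fin d → ℕ) :
    lowering j u n = ((√((n j : ℝ) + 1) : ℝ) : ℂ) * u (n + Pi.single j 1) := rfl

theorem raising_apply (j : Fin d) (u : (Fin d → ℕ) → ℂ) (n : Fin d → ℕ) :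
    raising j u n = ((√(n j : ℝ) : ℝ) : ℂ) * u (n - Pi.single j 1) := rfl

/-- The linear combination of ladder operators with coefficients `α` (annihilation) and `β`
(creation). -/
def ladder (α β : Fin d → ℂ) : Module.End ℂ ((Fin d → ℕ) → ℂ) :=
  ∑ j, (α j • lowering j + β j • raising j)

theorem ladder_apply (α β : Fin d → ℂ) (u : (Fin d → ℕ) → ℂ) (n : Fin d → ℕ) :
    ladder α β u n = ∑ j, (α j * lowering j u n + β j * raising j u n) := by
  simp [ladder, LinearMap.sum_apply, Finset.sum_apply]

theorem sub_single_add_single {n : Fin d → ℕ} {j : Fin d} (h : n j ≠ 0) :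
    n - Pi.single j 1 + Pi.single j 1 = n := by
  ext i
  by_cases hij : i = j
  · subst hij; simp; omega
  · simp [hij]

theorem lowering_mul_lowering (i j : Fin d) : lowering i * lowering j = lowering j * lowering i := by
  ext u n
  simp only [Module.End.mul_apply, lowering_apply, add_right_comm n (Pi.single i 1)]
  by_cases hij : i = j
  · subst hij; rfl
  · simp [hij, Ne.symm hij]; ring

theorem raising_mul_raising (i j : Fin d) : raising i * raising j = raising j * raising i := by
  ext u n
  simp only [Module.End.mul_apply, raising_apply, tsub_right_comm (a := n) (b := Pi.single i 1)]
  by_cases hij : i = j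
  · subst hij; rfl
  · simp [hij, Ne.symm hij]; ring

theorem lowering_mul_raising (i j : Fin d) :
    lowering i * raising j = raising j * lowering i + if i = j then 1 else 0 := by
  ext u n
  simp only [LinearMap.add_apply, Pi.add_apply, Module.End.mul_apply, lowering_apply, raising_apply]
  by_cases hij : i = j
  · subst hij
    simp only [Pi.single_eq_same, add_tsub_cancel_right, if_true,
      Module.End.one_apply]
    have h1 : ((√((n i : ℝ) + 1) : ℝ) : ℂ) * ((√((n i : ℝ) + 1) : ℝ) : ℂ) = n i + 1 := by
      rw [← Complex.ofReal_mul, Real.mul_self_sqrt (by positivity)]; push_cast; rfl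
    have h2 : ((√(n i : ℝ) : ℝ) : ℂ) * ((√(n i : ℝ) : ℝ) : ℂ) = n i := by
      rw [← Complex.ofReal_mul, Real.mul_self_sqrt (by positivity)]; push_cast; rfl
    rcases Nat.eq_zero_or_pos (n i) with h0 | h0
    · simp [h0]
    · rw [sub_single_add_single h0.ne']
      have h3 : (((n i - 1 : ℕ) : ℝ) + 1) = n i := by exact_mod_cast Nat.succ_pred_eq_of_pos h0
      push_cast [Pi.sub_apply, Pi.single_eq_same]
      rw [h3, ← mul_assoc, ← mul_assoc, h1, h2]
      ring
  · rw [if_neg hij]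
    rcases Nat.eq_zero_or_pos (n j) with h0 | h0
    · simp [h0, Ne.symm hij]
    · have : n + Pi.single i 1 - Pi.single j 1 = n - Pi.single j 1 + Pi.single i 1 := by
        refine (tsub_add_eq_add_tsub fun k => ?_).symm
        by_cases hk : k = j
        · subst hk; simpa using Nat.one_le_of_lt h0
        · simp [hk]
      rw [this]
      simp [hij, Ne.symm hij]; ring

theorem ladder_mul_ladder (α β α' β' : Fin d → ℂ) : ladder α β * ladder α' β' =
    ladder α' β' * ladder α β + (∑ j, (α j * β' j - β j * α' j)) • 1 := by
  have key : ∀ i j : Fin d, (α i • lowering i + β i • raising i) * (α' j • lowering j + β' j • raising j) =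
      (α' j • lowering j + β' j • raising j) * (α i • lowering i + β i • raising i) +
        if i = j then (α i * β' i - β i * α' i) • 1 else 0 := by
    intro i j
    have h1 := lowering_mul_raising i j
    have h2 := lowering_mul_raising j i
    simp only [mul_add, add_mul, smul_mul_smul_comm, lowering_mul_lowering i j, raising_mul_raising i j, h1,
      h2]
    by_cases hij : i = j
    · subst hij
      simp only [if_true]
      module
    · simp only [if_neg hij, if_neg (Ne.symm hij)]
      module
  rw [ladder, ladder, Finset.sum_mul_sum, Finset.sum_mul_sum, Finset.sum_comm (s := Finset.univ)
    (f := fun j i => (α' j • lowering j + β' j • raising j) * (α i • lowering i + β i • raising i)),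
    Finset.sum_smul, ← Finset.sum_add_distrib]
  refine Finset.sum_congr rfl fun i _ => ?_
  rw [Finset.sum_congr rfl fun j _ => key i j, Finset.sum_add_distrib, Finset.sum_ite_eq,
    if_pos (Finset.mem_univ _)]

theorem commute_ladder {α β α' β' : Fin d → ℂ} (h : ∑ j, (α j * β' j - β j * α' j) = 0) :
    Commute (ladder α β) (ladder α' β') := by
  rw [Commute, SemiconjBy, ladder_mul_ladder, h, zero_smul, add_zero]

/-- The total number of quanta in a number state. -/
def quanta (n : Fin d → ℕ) : ℕ := ∑ i, n i

/-- The operator that multiplies the coefficient of a number state by `t` to the number of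
quanta. -/
def attenuate (t : ℝ) : Module.End ℂ ((Fin d → ℕ) → ℂ) where
  toFun u n := (t : ℂ) ^ quanta n * u n
  map_add' u v := by ext n; simp [mul_add]
  map_smul' c u := by ext n; simp [mul_left_comm]

theorem attenuate_apply (t : ℝ) (u : (Fin d → ℕ) → ℂ) (n : Fin d → ℕ) :
    attenuate t u n = (t : ℂ) ^ quanta n * u n := rfl

theorem quanta_add_single (n : Fin d → ℕ) (j : Fin d) :
    quanta (n + Pi.single j 1) = quanta n + 1 := by
  simp [quanta, Finset.sum_add_distrib]

/-- Lowering reads a coefficient with one quantum more, raising one with a quantum fewer, so moving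
the damping past them costs `t⁻¹` and `t`. The result is again a ladder combination, with a slightly
changed commutator. -/
theorem attenuate_ladder {t : ℝ} (ht : t ≠ 0) (α β : Fin d → ℂ) (u : (Fin d → ℕ) → ℂ) :
    attenuate t (ladder α β u) =
      ladder (fun j => (t : ℂ)⁻¹ * α j) (fun j => t * β j) (attenuate t u) := by
  have ht' : (t : ℂ) ≠ 0 := by exact_mod_cast ht
  ext n
  rw [attenuate_apply, ladder_apply, ladder_apply, Finset.mul_sum]
  refine Finset.sum_congr rfl fun j _ => ?_
  simp only [lowering_apply, raising_apply, attenuate_apply, quanta_add_single]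
  rw [mul_add]
  congr 1
  · rw [pow_succ]; field_simp
  · rcases Nat.eq_zero_or_pos (n j) with h0 | h0
    · simp [h0]
    · have := quanta_add_single (n - Pi.single j 1) j
      rw [sub_single_add_single h0.ne'] at this
      rw [this, pow_succ]; ring

/-! ### Rapidly decreasing families as an invariant domain with adjoints. -/

theorem memℓp_two_iff {ι : Type*} {u : ι → ℂ} :
    Memℓp u 2 ↔ Summable fun n => ‖u n‖ ^ 2 := by
  rw [memℓp_gen_iff (by norm_num)]
  norm_num

/-- The rapidly decreasing families of coefficients. -/
def rapid (d : ℕ) : Submodule ℂ ((Fin d → ℕ) → ℂ) where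
  carrier := {u | ∀ k : ℕ, Memℓp (fun n => ((quanta n : ℂ) + 1) ^ k * u n) 2}
  zero_mem' k := by
    simp only [Pi.zero_apply, mul_zero]
    exact zero_memℓp
  add_mem' {u v} hu hv k := by
    have h := (hu k).add (hv k)
    convert h using 1
    ext n
    simp [mul_add]
  smul_mem' c u hu k := by
    have h := (hu k).const_smul c
    convert h using 1
    ext n
    simp [mul_left_comm]

theorem mem_rapid_iff {u : (Fin d → ℕ) → ℂ} :
    u ∈ rapid d ↔ ∀ k : ℕ, Summable fun n => (((quanta n : ℝ) + 1) ^ k * ‖u n‖) ^ 2 := by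
  refine forall_congr' fun k => ?_
  rw [memℓp_two_iff]
  refine summable_congr fun n => ?_
  rw [norm_mul, norm_pow]
  norm_cast

theorem single_le_quanta (n : Fin d → ℕ) (j : Fin d) : n j ≤ quanta n :=
  Finset.single_le_sum (fun i _ => Nat.zero_le (n i)) (Finset.mem_univ j)

theorem sqrt_le_quanta_add_one (n : Fin d → ℕ) (j : Fin d) :
    √((n j : ℝ) + 1) ≤ (quanta n : ℝ) + 1 := by
  have h : (n j : ℝ) ≤ (quanta n : ℝ) := by exact_mod_cast single_le_quanta n j
  rw [Real.sqrt_le_left (by positivity)]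
  nlinarith [Nat.cast_nonneg (α := ℝ) (quanta n)]

theorem lowering_mem_rapid (j : Fin d) {u : (Fin d → ℕ) → ℂ} (hu : u ∈ rapid d) :
    lowering j u ∈ rapid d := by
  rw [mem_rapid_iff] at hu ⊢
  intro k
  refine Summable.of_nonneg_of_le (fun n => sq_nonneg _) (fun n => ?_)
    ((hu (k + 1)).comp_injective (add_left_injective (Pi.single j 1)))
  simp only [Function.comp_apply, quanta_add_single, lowering_apply, norm_mul, Complex.norm_real,
    Real.norm_of_nonneg (Real.sqrt_nonneg _)]
  have h := sqrt_le_quanta_add_one n j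
  push_cast
  refine pow_le_pow_left₀ (by positivity) ?_ 2
  rw [pow_succ _ k, mul_assoc]
  gcongr
  · linarith
  · linarith

theorem exists_add_single_of_ne_zero {n : Fin d → ℕ} {j : Fin d}
    (h : n ∉ Set.range fun m : Fin d → ℕ => m + Pi.single j 1) : n j = 0 := by
  by_contra h0
  exact h ⟨_, sub_single_add_single h0⟩

theorem raising_mem_rapid (j : Fin d) {u : (Fin d → ℕ) → ℂ} (hu : u ∈ rapid d) :
    raising j u ∈ rapid d := by
  rw [mem_rapid_iff] at hu ⊢
  intro k
  -- Entries outside the range of the shift have `n j = 0` and are killed by the factor `√(n j)`.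
  rw [← (add_left_injective (Pi.single j 1 : Fin d → ℕ)).summable_iff fun n hn => by
    simp [raising_apply, exists_add_single_of_ne_zero hn]]
  refine Summable.of_nonneg_of_le (fun n => sq_nonneg _) (fun n => ?_)
    ((hu (k + 1)).mul_left ((2 ^ k) ^ 2))
  simp only [Function.comp_apply, quanta_add_single, raising_apply, norm_mul, Complex.norm_real,
    Real.norm_of_nonneg (Real.sqrt_nonneg _), add_tsub_cancel_right, Pi.add_apply,
    Pi.single_eq_same]
  rw [pow_succ _ k, ← mul_pow, ← mul_assoc, ← mul_assoc, ← mul_assoc, ← mul_pow]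
  have := sqrt_le_quanta_add_one n j
  push_cast at this ⊢
  gcongr
  linarith [Nat.cast_nonneg (α := ℝ) (quanta n)]

theorem attenuate_mem_rapid {t : ℝ} (h0 : 0 < t) (h1 : t < 1) {u : (Fin d → ℕ) → ℂ}
    (hu : Memℓp u 2) : attenuate t u ∈ rapid d := by
  rw [mem_rapid_iff]
  intro k
  obtain ⟨C, hC⟩ := (tendsto_pow_const_mul_const_pow_of_abs_lt_one k
    (by rwa [abs_of_pos h0] : |t| < 1)).bddAbove_range
  -- The bound `C` is applied at `n + 1`; the surplus power of `t` accounts for `t⁻¹`.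
  have hb : ∀ n : ℕ, ((n : ℝ) + 1) ^ k * t ^ n ≤ t⁻¹ * C := fun n => by
    have := hC ⟨n + 1, rfl⟩
    simp only [pow_succ] at this
    push_cast at this
    rw [← div_eq_inv_mul, le_div_iff₀ h0]
    linarith
  refine Summable.of_nonneg_of_le (fun n => sq_nonneg _) (fun n => ?_)
    ((memℓp_two_iff.1 hu).mul_left ((t⁻¹ * C) ^ 2))
  rw [← mul_pow, attenuate_apply, norm_mul, norm_pow, Complex.norm_real, Real.norm_of_nonneg h0.le,
    ← mul_assoc]
  exact pow_le_pow_left₀ (by positivity)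
    (mul_le_mul_of_nonneg_right (hb _) (norm_nonneg _)) 2

/-- The inclusion of the rapidly decreasing families into the Hilbert space. -/
def rapidToFock (d : ℕ) : rapid d →ₗ[ℂ] Fock d where
  toFun u := ⟨u.1, (by simpa using u.2 0 : Memℓp u.1 2)⟩
  map_add' _ _ := rfl
  map_smul' _ _ := rfl

theorem rapidToFock_apply (u : rapid d) (n : Fin d → ℕ) : rapidToFock d u n = u.1 n := rfl

theorem inner_lowering_left (j : Fin d) (u v : rapid d) :
    ⟪rapidToFock d ⟨lowering j u, lowering_mem_rapid j u.2⟩, rapidToFock d v⟫_ℂ =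
      ⟪rapidToFock d u, rapidToFock d ⟨raising j v, raising_mem_rapid j v.2⟩⟫_ℂ := by
  rw [lp.inner_eq_tsum, lp.inner_eq_tsum]
  rw [← (add_left_injective (Pi.single j 1 : Fin d → ℕ)).tsum_eq (f := fun n =>
    ⟪rapidToFock d u n, rapidToFock d ⟨raising j v, raising_mem_rapid j v.2⟩ n⟫_ℂ)]
  · refine tsum_congr fun n => ?_
    simp only [rapidToFock_apply, lowering_apply, raising_apply, RCLike.inner_apply, map_mul,
      Complex.conj_ofReal, Pi.add_apply, Pi.single_eq_same, add_tsub_cancel_right]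
    push_cast
    ring
  · intro n hn
    by_contra h
    exact hn (by simp [rapidToFock_apply, raising_apply, exists_add_single_of_ne_zero h])

theorem inner_raising_left (j : Fin d) (u v : rapid d) :
    ⟪rapidToFock d ⟨raising j u, raising_mem_rapid j u.2⟩, rapidToFock d v⟫_ℂ =
      ⟪rapidToFock d u, rapidToFock d ⟨lowering j v, lowering_mem_rapid j v.2⟩⟫_ℂ := by
  rw [← inner_conj_symm, ← inner_lowering_left, inner_conj_symm]

theorem ladder_mem_rapid (α β : Fin d → ℂ) {u : (Fin d → ℕ) → ℂ} (hu : u ∈ rapid d) :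
    ladder α β u ∈ rapid d := by
  rw [ladder, LinearMap.sum_apply]
  exact Submodule.sum_mem _ fun j _ => Submodule.add_mem _
    (Submodule.smul_mem _ _ (lowering_mem_rapid j hu)) (Submodule.smul_mem _ _ (raising_mem_rapid j hu))

/-- `ladder` on the rapidly decreasing families. -/
def rapidLadder (α β : Fin d → ℂ) : Module.End ℂ (rapid d) :=
  (ladder α β).restrict fun _ hu => ladder_mem_rapid α β hu

theorem rapidLadder_eq_sum (α β : Fin d → ℂ) (u : rapid d) :
    rapidLadder α β u = ∑ j, (α j • (⟨lowering j u, lowering_mem_rapid j u.2⟩ : rapid d) +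
      β j • (⟨raising j u, raising_mem_rapid j u.2⟩ : rapid d)) := by
  ext n
  simp [rapidLadder, ladder, LinearMap.coe_restrict_apply, LinearMap.sum_apply]

theorem inner_rapidLadder_left (α β : Fin d → ℂ) (u v : rapid d) :
    ⟪rapidToFock d (rapidLadder α β u), rapidToFock d v⟫_ℂ = ⟪rapidToFock d u, rapidToFock d
      (rapidLadder (fun j => starRingEnd ℂ (β j)) (fun j => starRingEnd ℂ (α j)) v)⟫_ℂ := by
  simp only [rapidLadder_eq_sum, map_sum, map_add, map_smul, sum_inner, inner_sum, inner_add_left,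
    inner_add_right, inner_smul_left, inner_smul_right, inner_lowering_left, inner_raising_left,
    add_comm]

theorem rapidLadder_mul_rapidLadder (α β : Fin d → ℂ) :
    rapidLadder (fun j => starRingEnd ℂ (β j)) (fun j => starRingEnd ℂ (α j)) * rapidLadder α β =
      rapidLadder α β * rapidLadder (fun j => starRingEnd ℂ (β j)) (fun j => starRingEnd ℂ (α j)) +
        ((∑ j, (‖β j‖ ^ 2 - ‖α j‖ ^ 2) : ℝ) : ℂ) • 1 := by
  have h := ladder_mul_ladder (fun j => starRingEnd ℂ (β j)) (fun j => starRingEnd ℂ (α j)) α β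
  refine LinearMap.ext fun u => Subtype.ext ?_
  have h' := LinearMap.congr_fun h u.1
  simp only [Complex.conj_mul'] at h'
  push_cast
  exact h'

end Sequences

/-! ### Lower bounds on the whole Hilbert space. -/

noncomputable section LowerBounds

open Polynomial Filter Topology

variable {d : ℕ}

theorem tsum_enorm_sq_eq_ofReal {ι : Type*} (f : lp (fun _ : ι => ℂ) 2) :
    ∑' n, ‖f n‖ₑ ^ 2 = ENNReal.ofReal (‖f‖ ^ 2) := by
  have h := lp.hasSum_norm (p := 2) (by norm_num) f
  norm_num at h
  rw [← h.tsum_eq, ENNReal.ofReal_tsum_of_nonneg (fun n => by positivity) h.summable]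
  exact tsum_congr fun n => by rw [ENNReal.ofReal_pow (norm_nonneg _), ofReal_norm]

theorem memℓp_two_of_tsum_ne_top {ι : Type*} {u : ι → ℂ} (h : ∑' n, ‖u n‖ₑ ^ 2 ≠ ∞) :
    Memℓp u 2 := by
  rw [memℓp_two_iff]
  have := ENNReal.summable_toReal h
  simpa using this

theorem aeval_attenuate_ladder {t : ℝ} (ht : t ≠ 0) (α β : Fin d → ℂ) (P : ℂ[X])
    (u : (Fin d → ℕ) → ℂ) : attenuate t (aeval (ladder α β) P u) =
      aeval (ladder (fun j => (t : ℂ)⁻¹ * α j) (fun j => t * β j)) P (attenuate t u) :=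
  LinearMap.comp_aeval_of_comp (f := attenuate t) (attenuate_ladder ht α β) P u

theorem aeval_rapidLadder (α β : Fin d → ℂ) (P : ℂ[X]) (u : rapid d) :
    (aeval (rapidLadder α β) P u : (Fin d → ℕ) → ℂ) = aeval (ladder α β) P (u : (Fin d → ℕ) → ℂ) :=
  LinearMap.comp_aeval_of_comp (f := (rapid d).subtype) (fun _ => rfl) P u

/-- For `[D†, D] = κ > 0` and a polynomial `P` of degree at most `m` with coefficient `c` at `m`,
`‖P(D) φ‖² ≥ m! κ^m |c|² ‖φ‖²` for every `φ` in the Hilbert space. -/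
theorem tsum_aeval_ladder_ge {α β : Fin d → ℂ} (hκ : 0 < ∑ j, (‖β j‖ ^ 2 - ‖α j‖ ^ 2))
    {P : ℂ[X]} {m : ℕ} (hP : P.natDegree ≤ m) {φ : (Fin d → ℕ) → ℂ} (hφ : Memℓp φ 2) :
    ENNReal.ofReal (m.factorial * (∑ j, (‖β j‖ ^ 2 - ‖α j‖ ^ 2)) ^ m * ‖P.coeff m‖ ^ 2) *
      ∑' n, ‖φ n‖ₑ ^ 2 ≤ ∑' n, ‖aeval (ladder α β) P φ n‖ₑ ^ 2 := by
  -- The commutator after damping; it is continuous at `t = 1`, hence still positive nearby.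
  set κ : ℝ → ℝ := fun t => ∑ j, (‖(t : ℂ) * β j‖ ^ 2 - ‖(t : ℂ)⁻¹ * α j‖ ^ 2) with hκdef
  have hκ1 : κ 1 = ∑ j, (‖β j‖ ^ 2 - ‖α j‖ ^ 2) := by simp [hκdef]
  have hcont : ContinuousAt κ 1 := by
    have : ContinuousAt (fun t : ℝ => (t : ℂ)⁻¹) 1 :=
      (Complex.continuous_ofReal.continuousAt).inv₀ (by simp)
    simp only [hκdef]
    fun_prop
  rw [← hκ1] at hκ ⊢
  -- With finite partial sums on the left, that side is continuous in `t` and the limit needs no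
  -- interchange.
  rw [ENNReal.tsum_eq_iSup_sum, ENNReal.mul_iSup]
  refine iSup_le fun s => ?_
  have hs : ∀ t : ℝ, 0 < t → t < 1 → 0 < κ t → ENNReal.ofReal (m.factorial * κ t ^ m *
      ‖P.coeff m‖ ^ 2 * ∑ n ∈ s, ‖attenuate t φ n‖ ^ 2) ≤
        ∑' n, ‖aeval (ladder α β) P φ n‖ₑ ^ 2 := by
    intro t h0 h1 hκt
    set u : rapid d := ⟨attenuate t φ, attenuate_mem_rapid h0 h1 hφ⟩ with hu
    set α' : Fin d → ℂ := fun j => (t : ℂ)⁻¹ * α j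
    set β' : Fin d → ℂ := fun j => t * β j
    have key := norm_aeval_sq_ge hκt.le (inner_rapidLadder_left α' β')
      (rapidLadder_mul_rapidLadder α' β') hP u
    have hsum : ∑ n ∈ s, ‖attenuate t φ n‖ ^ 2 ≤ ‖rapidToFock d u‖ ^ 2 := by
      have := lp.sum_rpow_le_norm_rpow (p := 2) (by norm_num) (rapidToFock d u) s
      norm_num at this
      exact this
    calc _ ≤ ENNReal.ofReal (‖rapidToFock d (aeval (rapidLadder α' β') P u)‖ ^ 2) :=
          ENNReal.ofReal_le_ofReal ((mul_le_mul_of_nonneg_left hsum (by positivity)).trans key)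
      _ = ∑' n, ‖attenuate t (aeval (ladder α β) P φ) n‖ₑ ^ 2 := by
          rw [← tsum_enorm_sq_eq_ofReal, aeval_attenuate_ladder h0.ne', ← aeval_rapidLadder α' β' P u]
          rfl
      _ ≤ _ := by
          refine ENNReal.tsum_le_tsum fun n => ?_
          gcongr
          rw [attenuate_apply, enorm_mul, enorm_pow]
          refine mul_le_of_le_one_left' (pow_le_one' ?_ _)
          rw [← ofReal_norm, Complex.norm_real, Real.norm_of_nonneg h0.le]
          simpa using h1.le
  have hlim : ContinuousAt (fun t : ℝ => ENNReal.ofReal (m.factorial * κ t ^ m *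
      ‖P.coeff m‖ ^ 2 * ∑ n ∈ s, ‖attenuate t φ n‖ ^ 2)) 1 := by
    refine ENNReal.continuous_ofReal.continuousAt.comp ?_
    simp only [attenuate_apply]
    fun_prop
  have hle := le_of_tendsto (hlim.tendsto.mono_left nhdsWithin_le_nhds : Tendsto _ (𝓝[<] (1 : ℝ)) _)
    (b := ∑' n, ‖aeval (ladder α β) P φ n‖ₑ ^ 2) (by
      filter_upwards [self_mem_nhdsWithin, nhdsWithin_le_nhds (lt_mem_nhds (zero_lt_one' ℝ)),
        (hcont.tendsto.eventually (lt_mem_nhds hκ)).filter_mono nhdsWithin_le_nhds] with t h1 h0 h2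
      exact hs t h0 h1 h2)
  refine le_trans (le_of_eq ?_) hle
  rw [ENNReal.ofReal_mul (p := m.factorial * κ 1 ^ m * ‖P.coeff m‖ ^ 2) (by positivity),
    ENNReal.ofReal_sum_of_nonneg (fun _ _ => by positivity)]
  congr 1
  refine Finset.sum_congr rfl fun n _ => ?_
  rw [ENNReal.ofReal_pow (norm_nonneg _), ofReal_norm]
  simp [attenuate_apply]

/-! ### Product vectors: slicing along the modes outside `G`. -/

/-- The coefficients `α` of the modes in `G`, and zero for the other modes. -/
def onModes (G : Finset (Fin d)) (α : Fin d → ℂ) : Fin d → ℂ := fun j => if j ∈ G then α j else 0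

theorem ladder_onModes_apply (G : Finset (Fin d)) (α β : Fin d → ℂ) (u : (Fin d → ℕ) → ℂ)
    (n : Fin d → ℕ) : ladder (onModes G α) (onModes G β) u n =
      ∑ j ∈ G, (α j * lowering j u n + β j * raising j u n) := by
  rw [ladder_apply, ← Finset.sum_filter_add_sum_filter_not Finset.univ (· ∈ G)]
  rw [Finset.sum_eq_zero (s := {x | x ∉ G}) fun j hj => by
    simp only [Finset.mem_filter] at hj; simp [onModes, hj.2]]
  simp only [Finset.filter_univ_mem, add_zero]
  exact Finset.sum_congr rfl fun j hj => by simp [onModes, hj]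

theorem dependsOn_ladder_onModes {G : Finset (Fin d)} (α β : Fin d → ℂ) {u : (Fin d → ℕ) → ℂ}
    (hu : DependsOn u (G : Set (Fin d))) :
    DependsOn (ladder (onModes G α) (onModes G β) u) (G : Set (Fin d)) := by
  intro x y hxy
  rw [ladder_onModes_apply, ladder_onModes_apply]
  refine Finset.sum_congr rfl fun j hj => ?_
  rw [lowering_apply, lowering_apply, raising_apply, raising_apply, hxy j hj,
    hu (x := x + Pi.single j 1) (y := y + Pi.single j 1) fun i hi => by simp [hxy i hi],
    hu (x := x - Pi.single j 1) (y := y - Pi.single j 1) fun i hi => by simp [hxy i hi]]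

theorem dependsOn_aeval_ladder_onModes {G : Finset (Fin d)} (α β : Fin d → ℂ) (P : ℂ[X])
    {u : (Fin d → ℕ) → ℂ} (hu : DependsOn u (G : Set (Fin d))) :
    DependsOn (aeval (ladder (onModes G α) (onModes G β)) P u) (G : Set (Fin d)) := by
  induction P using Polynomial.induction_on generalizing u with
  | C a => intro x y hxy; simp [Algebra.algebraMap_eq_smul_one, hu hxy]
  | add P Q hP hQ => intro x y hxy; simp [hP hu hxy, hQ hu hxy]
  | monomial n a ih =>
    rw [pow_succ, ← mul_assoc, map_mul, aeval_X, Module.End.mul_apply]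
    exact ih (dependsOn_ladder_onModes α β hu)

/-- On `φ χ`, where `φ` depends on the modes in `G` and `χ` on the others, the power of a linear
combination of ladder operators is, for fixed occupation of the other modes, a polynomial in the
part of the combination in `G`, with leading coefficient `χ`. -/
theorem exists_ladder_pow_eq_aeval (G : Finset (Fin d)) (α β : Fin d → ℂ)
    {φ χ : (Fin d → ℕ) → ℂ} (hφ : DependsOn φ (G : Set (Fin d)))
    (hχ : DependsOn χ (G : Set (Fin d))ᶜ) (m : ℕ) :
    ∃ P : (Fin d → ℕ) → ℂ[X], DependsOn P (G : Set (Fin d))ᶜ ∧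
      (∀ n, (P n).natDegree ≤ m ∧ (P n).coeff m = χ n) ∧
      ∀ n, (ladder α β ^ m) (φ * χ) n =
        aeval (ladder (onModes G α) (onModes G β)) (P n) φ n := by
  induction m with
  | zero =>
    refine ⟨fun n => C (χ n), fun x y hxy => by simp only [hχ hxy], fun n => by simp, fun n => ?_⟩
    simp [Algebra.algebraMap_eq_smul_one, mul_comm]
  | succ m ih =>
    obtain ⟨P, hdep, hdeg, hP⟩ := ih
    -- One more factor of the combination: its part in `G` multiplies by `X`, while its part outside
    -- `G` acts on the occupations that index the coefficients and does not raise the degree.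
    refine ⟨fun n => X * P n + ∑ j ∈ Gᶜ, (C (α j * ((√((n j : ℝ) + 1) : ℝ) : ℂ)) *
      P (n + Pi.single j 1) + C (β j * ((√(n j : ℝ) : ℝ) : ℂ)) * P (n - Pi.single j 1)),
      fun x y hxy => ?_, fun n => ⟨?_, ?_⟩, fun n => ?_⟩
    · simp only
      rw [hdep hxy]
      congr 1
      refine Finset.sum_congr rfl fun j hj => ?_
      rw [hxy j (by simpa using hj),
        hdep (x := x + Pi.single j 1) (y := y + Pi.single j 1) fun i hi => by simp [hxy i hi],
        hdep (x := x - Pi.single j 1) (y := y - Pi.single j 1) fun i hi => by simp [hxy i hi]]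
    · refine natDegree_add_le_of_degree_le ((natDegree_mul_le).trans ?_)
        (natDegree_sum_le_of_forall_le _ _ fun j _ => natDegree_add_le_of_degree_le ?_ ?_)
      · rw [natDegree_X]; have := (hdeg n).1; omega
      · exact (natDegree_C_mul_le _ _).trans ((hdeg _).1.trans m.le_succ)
      · exact (natDegree_C_mul_le _ _).trans ((hdeg _).1.trans m.le_succ)
    · have h0 : ∀ k, (P k).coeff (m + 1) = 0 := fun k =>
        coeff_eq_zero_of_natDegree_lt ((hdeg k).1.trans_lt m.lt_succ_self)
      simp only [coeff_add, coeff_X_mul, h0, (hdeg n).2, finsetSum_coeff, coeff_C_mul, mul_zero,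
        add_zero, Finset.sum_const_zero]
    · set X' := ladder (onModes G α) (onModes G β) with hX'
      rw [pow_succ', Module.End.mul_apply, ladder_apply, ← Finset.sum_add_sum_compl G,
        map_add, LinearMap.add_apply, Pi.add_apply, map_mul (aeval X'), aeval_X,
        Module.End.mul_apply]
      congr 1
      · rw [hX', ladder_onModes_apply]
        refine Finset.sum_congr rfl fun j hj => ?_
        have hne : ∀ i ∈ (G : Set (Fin d))ᶜ, i ≠ j := fun i hi h => hi (h ▸ hj)
        simp only [lowering_apply, raising_apply, hP]
        rw [hdep (x := n + Pi.single j 1) (y := n) fun i hi => by simp [hne i hi],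
          hdep (x := n - Pi.single j 1) (y := n) fun i hi => by simp [hne i hi]]
      · rw [map_sum, LinearMap.sum_apply, Finset.sum_apply]
        refine Finset.sum_congr rfl fun j hj => ?_
        have hne : ∀ i ∈ (G : Set (Fin d)), i ≠ j := fun i hi h =>
          (Finset.mem_compl.1 hj) (h ▸ hi)
        simp only [lowering_apply, raising_apply, hP]
        rw [dependsOn_aeval_ladder_onModes α β _ hφ (x := n + Pi.single j 1) (y := n)
            fun i hi => by simp [hne i hi],
          dependsOn_aeval_ladder_onModes α β _ hφ (x := n - Pi.single j 1) (y := n)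
            fun i hi => by simp [hne i hi]]
        simp [Algebra.algebraMap_eq_smul_one, hX']
        ring

theorem mulLeft_indicator_ladder_onModes (G : Finset (Fin d)) (α β : Fin d → ℂ)
    {S : Set (Fin d → ℕ)} (hS : DependsOn (· ∈ S) (G : Set (Fin d))ᶜ) (u : (Fin d → ℕ) → ℂ) :
    LinearMap.mulLeft ℂ (S.indicator 1) (ladder (onModes G α) (onModes G β) u) =
      ladder (onModes G α) (onModes G β) (LinearMap.mulLeft ℂ (S.indicator 1) u) := by
  classical
  ext n
  simp only [LinearMap.mulLeft_apply, Pi.mul_apply, ladder_onModes_apply, Finset.mul_sum]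
  refine Finset.sum_congr rfl fun j hj => ?_
  have hne : ∀ i ∈ (G : Set (Fin d))ᶜ, i ≠ j := fun i hi h => hi (h ▸ hj)
  have h1 : n + Pi.single j 1 ∈ S ↔ n ∈ S := iff_of_eq (hS fun i hi => by simp [hne i hi])
  have h2 : n - Pi.single j 1 ∈ S ↔ n ∈ S := iff_of_eq (hS fun i hi => by simp [hne i hi])
  simp only [lowering_apply, raising_apply, Pi.mul_apply, Set.indicator_apply, h1, h2]
  split_ifs <;> simp

/-- The function `u` of the occupation numbers is a product of a function of the modes in `G` and a
function of the other modes. -/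
def Splits (G : Finset (Fin d)) (u : (Fin d → ℕ) → ℂ) : Prop :=
  ∃ φ χ : (Fin d → ℕ) → ℂ, DependsOn φ (G : Set (Fin d)) ∧ DependsOn χ (G : Set (Fin d))ᶜ ∧
    u = φ * χ

theorem Splits.compl {G : Finset (Fin d)} {u : (Fin d → ℕ) → ℂ} (h : Splits G u) :
    Splits Gᶜ u := by
  obtain ⟨φ, χ, hφ, hχ, rfl⟩ := h
  exact ⟨χ, φ, by simpa using hχ, by simpa using hφ, mul_comm _ _⟩

/-- Slice by slice this is `tsum_aeval_ladder_ge` for the part in `G`; only its commutator has to be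
positive, that of the other part may have any sign. -/
theorem Splits.tsum_ladder_pow_ge {G : Finset (Fin d)} {α β : Fin d → ℂ} {κ : ℝ}
    (hκ : ∑ j ∈ G, (‖β j‖ ^ 2 - ‖α j‖ ^ 2) = κ) (h0 : 0 < κ) {u : (Fin d → ℕ) → ℂ}
    (hu : Splits G u) (hfin : ∑' n, ‖u n‖ₑ ^ 2 ≠ ∞) (m : ℕ) :
    ENNReal.ofReal (m.factorial * κ ^ m) * ∑' n, ‖u n‖ₑ ^ 2 ≤
      ∑' n, ‖(ladder α β ^ m) u n‖ₑ ^ 2 := by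
  classical
  obtain ⟨φ, χ, hφ, hχ, rfl⟩ := hu
  obtain ⟨P, hdep, hdeg, hP⟩ := exists_ladder_pow_eq_aeval G α β hφ hχ m
  have hκ' : ∑ j, (‖onModes G β j‖ ^ 2 - ‖onModes G α j‖ ^ 2) = κ := by
    rw [← hκ, ← Finset.sum_add_sum_compl G, Finset.sum_eq_zero (s := Gᶜ), add_zero]
    · exact Finset.sum_congr rfl fun j hj => by simp [onModes, hj]
    · intro j hj
      simp [onModes, Finset.mem_compl.1 hj]
  -- `r` forgets the occupations in `G`; its fibres are the slices.
  set r : (Fin d → ℕ) → (Fin d → ℕ) := fun n j => if j ∈ G then 0 else n j with hr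
  have hrn : ∀ n, ∀ i ∈ (G : Set (Fin d))ᶜ, r n i = n i := fun n i hi => by
    have : i ∉ G := hi
    simp [hr, this]
  have hfib : ∀ f : (Fin d → ℕ) → ℝ≥0∞, ∑' n, f n = ∑' c, ∑' n, if r n = c then f n else 0 := by
    intro f
    rw [ENNReal.tsum_comm]
    exact tsum_congr fun n => (tsum_ite_eq' (r n) fun _ => f n).symm
  rw [hfib fun n => ‖(φ * χ) n‖ₑ ^ 2, hfib fun n => ‖(ladder α β ^ m) (φ * χ) n‖ₑ ^ 2,
    ← ENNReal.tsum_mul_left]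
  refine ENNReal.tsum_le_tsum fun c => ?_
  set S : Set (Fin d → ℕ) := {n | r n = c} with hS
  have hSdep : DependsOn (· ∈ S) (G : Set (Fin d))ᶜ := by
    intro x y hxy
    have : r x = r y := by
      ext j
      by_cases hj : j ∈ G
      · simp [hr, hj]
      · simp [hr, hj, hxy j hj]
    simp [hS, this]
  -- Cutting `φ` down to one slice makes it square-summable and commutes with operators on `G`.
  set v : (Fin d → ℕ) → ℂ := LinearMap.mulLeft ℂ (S.indicator 1) φ with hv
  have hvn : ∀ n, v n = if r n = c then φ n else 0 := fun n => by
    simp [hv, Set.indicator_apply, hS]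
  have hχc : ∀ n, r n = c → χ n = χ c := fun n hn => hχ fun i hi => by rw [← hn, hrn n i hi]
  have hleft : ENNReal.ofReal (m.factorial * κ ^ m) *
      ∑' n, (if r n = c then ‖(φ * χ) n‖ₑ ^ 2 else 0) =
        ENNReal.ofReal (m.factorial * κ ^ m * ‖(P c).coeff m‖ ^ 2) * ∑' n, ‖v n‖ₑ ^ 2 := by
    rw [ENNReal.ofReal_mul (p := m.factorial * κ ^ m) (q := ‖(P c).coeff m‖ ^ 2) (by positivity),
      mul_assoc, (hdeg c).2, ENNReal.ofReal_pow (norm_nonneg _), ofReal_norm]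
    congr 1
    rw [← ENNReal.tsum_mul_left]
    refine tsum_congr fun n => ?_
    rw [hvn]
    split_ifs with h
    · rw [Pi.mul_apply, hχc n h, enorm_mul, mul_pow, mul_comm]
    · simp
  have hright : ∑' n, (if r n = c then ‖(ladder α β ^ m) (φ * χ) n‖ₑ ^ 2 else 0) =
      ∑' n, ‖aeval (ladder (onModes G α) (onModes G β)) (P c) v n‖ₑ ^ 2 := by
    refine tsum_congr fun n => ?_
    rw [hv, ← LinearMap.comp_aeval_of_comp (f := LinearMap.mulLeft ℂ (S.indicator 1))
      (mulLeft_indicator_ladder_onModes G α β hSdep) (P c) φ]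
    have : r n = c → P n = P c := fun hn => hdep fun i hi => by rw [← hn, hrn n i hi]
    by_cases h : r n = c
    · simp [h, hS, hP, this h]
    · simp [h, hS]
  rw [hleft, hright]
  -- If `χ c ≠ 0`, then `χ c • v` is a piece of `u`, so `v` has finite norm; otherwise the left side
  -- is zero.
  by_cases hc : χ c = 0
  · simp [(hdeg c).2, hc]
  rw [← hκ'] at h0 ⊢
  refine tsum_aeval_ladder_ge h0 (hdeg c).1 (memℓp_two_of_tsum_ne_top fun htop => hfin ?_)
  rw [eq_top_iff]
  calc (∞ : ℝ≥0∞) = ‖χ c‖ₑ ^ 2 * ∑' n, ‖v n‖ₑ ^ 2 := by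
        rw [htop, ENNReal.mul_top (by simpa using hc)]
    _ ≤ _ := by
        rw [← ENNReal.tsum_mul_left]
        refine ENNReal.tsum_le_tsum fun n => ?_
        rw [hvn]
        split_ifs with h
        · rw [Pi.mul_apply, hχc n h, enorm_mul, mul_pow, mul_comm]
        · simp

end LowerBounds

/-! ### Gram decompositions of states and their second moments. -/

noncomputable section Decompositions

variable {d : ℕ}

/-- The kernel `K` is a sum of rank-one kernels `conj (u n) * u m` with all `u` in `C`. -/
def IsGram (C : Set ((Fin d → ℕ) → ℂ)) (K : (Fin d → ℕ) → (Fin d → ℕ) → ℂ) : Prop :=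
  ∃ (ι : Type) (u : ι → (Fin d → ℕ) → ℂ), (∀ k, u k ∈ C) ∧
    ∀ n m, HasSum (fun k => starRingEnd ℂ (u k n) * u k m) (K n m)

theorem IsGram.mono {C D : Set ((Fin d → ℕ) → ℂ)} {K : (Fin d → ℕ) → (Fin d → ℕ) → ℂ}
    (h : IsGram C K) (hCD : C ⊆ D) : IsGram D K := by
  obtain ⟨ι, u, hu, hK⟩ := h
  exact ⟨ι, u, fun k => hCD (hu k), hK⟩

theorem HasSum.mul_prod {ι κ : Type*} {a : ι → ℂ} {b : κ → ℂ} {x y : ℂ} (ha : HasSum a x)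
    (hb : HasSum b y) : HasSum (fun z : ι × κ => a z.1 * b z.2) (x * y) :=
  ha.mul hb (summable_mul_of_summable_norm ha.summable.norm hb.summable.norm)

theorem IsGram.mul {C D : Set ((Fin d → ℕ) → ℂ)} {K L : (Fin d → ℕ) → (Fin d → ℕ) → ℂ}
    (hK : IsGram C K) (hL : IsGram D L) :
    IsGram {w | ∃ u ∈ C, ∃ v ∈ D, w = u * v} fun n m => K n m * L n m := by
  obtain ⟨ι, u, hu, hK⟩ := hK
  obtain ⟨κ, v, hv, hL⟩ := hL
  refine ⟨ι × κ, fun x n => u x.1 n * v x.2 n, fun x => ⟨u x.1, hu x.1, v x.2, hv x.2, rfl⟩,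
    fun n m => ?_⟩
  refine ((hK n m).mul_prod (hL n m)).congr_fun fun x => ?_
  rw [map_mul, mul_mul_mul_comm]

theorem IsGram.comp {k : ℕ} {C : Set ((Fin k → ℕ) → ℂ)} {K : (Fin k → ℕ) → (Fin k → ℕ) → ℂ}
    (hK : IsGram C K) (f : Fin k → Fin d) :
    IsGram {w | ∃ u ∈ C, w = fun n => u (n ∘ f)} fun n m => K (n ∘ f) (m ∘ f) := by
  obtain ⟨ι, u, hu, hK⟩ := hK
  exact ⟨ι, fun i n => u i (n ∘ f), fun i => ⟨_, hu i, rfl⟩, fun n m => hK _ _⟩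

/-- The weights are absorbed as `√(p i)`. On the diagonal all terms are nonnegative, so the double
family is summable; off the diagonal it is dominated by `|x y| ≤ |x|² + |y|²`. -/
theorem isGram_of_hasSum {C : Set ((Fin d → ℕ) → ℂ)} (hC : ∀ (c : ℂ), ∀ u ∈ C, c • u ∈ C)
    {p : ℕ → ℝ} (hp : ∀ i, 0 ≤ p i) {L : ℕ → (Fin d → ℕ) → (Fin d → ℕ) → ℂ}
    (hL : ∀ i, IsGram C (L i)) {K : (Fin d → ℕ) → (Fin d → ℕ) → ℂ}
    (hK : ∀ n m, HasSum (fun i => (p i : ℂ) * L i n m) (K n m)) : IsGram C K := by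
  choose ι u hu hs using hL
  have hsq : ∀ i, starRingEnd ℂ ((√(p i) : ℝ) : ℂ) * ((√(p i) : ℝ) : ℂ) = p i := fun i => by
    rw [Complex.conj_ofReal, ← Complex.ofReal_mul, Real.mul_self_sqrt (hp i)]
  have hfib : ∀ n m i, HasSum (fun k => starRingEnd ℂ ((((√(p i) : ℝ) : ℂ) • u i k) n) *
      (((√(p i) : ℝ) : ℂ) • u i k) m) ((p i : ℂ) * L i n m) := fun n m i => by
    refine ((hs i n m).mul_left (p i : ℂ)).congr_fun fun k => ?_
    rw [← hsq i]
    simp only [Pi.smul_apply, smul_eq_mul, map_mul]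
    ring
  refine ⟨Σ i, ι i, fun x => ((√(p x.1) : ℝ) : ℂ) • u x.1 x.2, fun x => hC _ _ (hu _ _),
    fun n m => ?_⟩
  have hdiag : ∀ n, Summable fun x : Σ i, ι i => ‖(((√(p x.1) : ℝ) : ℂ) • u x.1 x.2) n‖ ^ 2 := by
    intro n
    have hre : ∀ i, HasSum (fun k => ‖(((√(p i) : ℝ) : ℂ) • u i k) n‖ ^ 2)
        ((p i : ℂ) * L i n n).re := fun i => by
      refine (Complex.hasSum_re (hfib n n i)).congr_fun fun k => ?_
      rw [Complex.conj_mul']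
      norm_cast
    rw [summable_sigma_of_nonneg fun _ => by positivity]
    refine ⟨fun i => (hre i).summable, ?_⟩
    simp only [fun i => (hre i).tsum_eq]
    exact (Complex.hasSum_re (hK n n)).summable
  refine (hK n m).sigma_of_hasSum (hfib n m) (Summable.of_norm_bounded
    ((hdiag n).add (hdiag m)) fun x => ?_)
  rw [norm_mul, RCLike.norm_conj]
  nlinarith [sq_nonneg (‖(((√(p x.1) : ℝ) : ℂ) • u x.1 x.2) n‖ -
    ‖(((√(p x.1) : ℝ) : ℂ) • u x.1 x.2) m‖), norm_nonneg ((((√(p x.1) : ℝ) : ℂ) • u x.1 x.2) n),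
    norm_nonneg ((((√(p x.1) : ℝ) : ℂ) • u x.1 x.2) m)]

theorem IsMixture.isGram {S : Set (DensityOperator d)} {ρ : DensityOperator d}
    (h : IsMixture S ρ) {C : Set ((Fin d → ℕ) → ℂ)} (hC : ∀ (c : ℂ), ∀ u ∈ C, c • u ∈ C)
    (hS : ∀ σ ∈ S, IsGram C σ.elem) : IsGram C ρ.elem := by
  obtain ⟨p, σ, hp, -, hσ, hsum⟩ := h
  refine isGram_of_hasSum hC hp (fun i => hS _ (hσ i)) fun n m => ?_
  have := ((innerSL ℂ (ket n)).comp (ContinuousLinearMap.apply ℂ (Fock d) (ket m))).hasSum hsum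
  simpa [DensityOperator.elem, inner_smul_right] using this

theorem ContinuousLinearMap.IsPositive.exists_eq_star_mul_self {H : Type*} [NormedAddCommGroup H]
    [InnerProductSpace ℂ H] [CompleteSpace H] {T : H →L[ℂ] H} (h : T.IsPositive) :
    ∃ b, T = star b * b :=
  CStarAlgebra.nonneg_iff_eq_star_mul_self.1 ((ContinuousLinearMap.nonneg_iff_isPositive T).2 h)

/-- Write the operator as `b† b`; the rows of `b` are the required families. -/
theorem DensityOperator.isGram (ρ : DensityOperator d) : IsGram Set.univ ρ.elem := by
  obtain ⟨b, hb⟩ := ρ.isPositive.exists_eq_star_mul_self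
  refine ⟨Fin d → ℕ, fun k n => b (ket n) k, fun _ => Set.mem_univ _, fun n m => ?_⟩
  have h : ρ.elem n m = ⟪b (ket n), b (ket m)⟫_ℂ := by
    rw [DensityOperator.elem, hb, ContinuousLinearMap.star_eq_adjoint,
      ContinuousLinearMap.mul_def, ContinuousLinearMap.comp_apply, ContinuousLinearMap.adjoint_inner_right]
  rw [h]
  refine (lp.hasSum_inner (b (ket n)) (b (ket m))).congr_fun fun k => ?_
  rw [RCLike.inner_apply, mul_comm]

theorem hasSum_inner_toFock {ρ : DensityOperator d} {ι : Type} {u : ι → (Fin d → ℕ) → ℂ}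
    (hu : ∀ n m, HasSum (fun k => starRingEnd ℂ (u k n) * u k m) (ρ.elem n m))
    (v : FiniteFock d) : HasSum (fun k => ‖Finsupp.linearCombination ℂ (u k) v‖ ^ 2)
      (RCLike.re ⟪toFock v, ρ.op (toFock v)⟫_ℂ) := by
  have h1 : ⟪toFock v, ρ.op (toFock v)⟫_ℂ =
      ∑ n ∈ v.support, ∑ m ∈ v.support, (starRingEnd ℂ (v n) * v m) * ρ.elem n m := by
    simp only [toFock, Finsupp.linearCombination_apply, Finsupp.sum, map_sum, map_smul, sum_inner,
      inner_sum, inner_smul_left, inner_smul_right, DensityOperator.elem]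
    rw [Finset.sum_comm]
    simp only [Finset.mul_sum]
    exact Finset.sum_congr rfl fun n _ => Finset.sum_congr rfl fun m _ => by ring
  have h2 : HasSum (fun k => ∑ n ∈ v.support, ∑ m ∈ v.support,
      (starRingEnd ℂ (v n) * v m) * (starRingEnd ℂ (u k n) * u k m))
      ⟪toFock v, ρ.op (toFock v)⟫_ℂ := by
    rw [h1]
    exact hasSum_sum fun n _ => hasSum_sum fun m _ => (hu n m).mul_left _
  refine (Complex.hasSum_re h2).congr_fun fun k => ?_
  have h3 : ∑ n ∈ v.support, ∑ m ∈ v.support,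
      (starRingEnd ℂ (v n) * v m) * (starRingEnd ℂ (u k n) * u k m) =
        starRingEnd ℂ (Finsupp.linearCombination ℂ (u k) v) *
          Finsupp.linearCombination ℂ (u k) v := by
    simp only [Finsupp.linearCombination_apply, Finsupp.sum, map_sum, smul_eq_mul, map_mul,
      Finset.sum_mul_sum]
    exact Finset.sum_congr rfl fun n _ => Finset.sum_congr rfl fun m _ => by ring
  rw [h3, Complex.conj_mul']
  norm_cast

theorem IsGram.exists_mean_eq_tsum {C : Set ((Fin d → ℕ) → ℂ)} {ρ : DensityOperator d}
    (h : IsGram C ρ.elem) : ∃ (ι : Type) (u : ι → (Fin d → ℕ) → ℂ), (∀ k, u k ∈ C) ∧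
      (∑' k, ∑' n, ‖u k n‖ₑ ^ 2 = 1) ∧ ∀ M : ModeOp d, meanMulAdjoint ρ M =
        ∑' k, ∑' n, ‖Finsupp.linearCombination ℂ (u k) (M (Finsupp.single n 1))‖ₑ ^ 2 := by
  obtain ⟨ι, u, huC, hu⟩ := h
  have key : ∀ v : FiniteFock d, ENNReal.ofReal (RCLike.re ⟪toFock v, ρ.op (toFock v)⟫_ℂ) =
      ∑' k, ‖Finsupp.linearCombination ℂ (u k) v‖ₑ ^ 2 := fun v => by
    have h := hasSum_inner_toFock hu v
    rw [← h.tsum_eq, ENNReal.ofReal_tsum_of_nonneg (fun _ => by positivity) h.summable]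
    exact tsum_congr fun k => by rw [ENNReal.ofReal_pow (norm_nonneg _), ofReal_norm]
  have hmean : ∀ M : ModeOp d, meanMulAdjoint ρ M =
      ∑' k, ∑' n, ‖Finsupp.linearCombination ℂ (u k) (M (Finsupp.single n 1))‖ₑ ^ 2 := fun M => by
    rw [meanMulAdjoint, ENNReal.tsum_comm]
    exact tsum_congr fun n => key _
  refine ⟨ι, u, huC, ?_, hmean⟩
  -- `M = 1` turns the unit trace into the normalization of the decomposition.
  have h1 := hmean 1
  simp only [Module.End.one_apply, Finsupp.linearCombination_single, one_smul] at h1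
  rw [← h1, meanMulAdjoint]
  have htr := Complex.hasSum_re ρ.hasSum_trace
  have hket : ∀ n : Fin d → ℕ, toFock ((1 : ModeOp d) (Finsupp.single n 1)) = ket n := fun n => by
    simp [toFock]
  simp only [hket]
  rw [← ENNReal.ofReal_tsum_of_nonneg (fun n => ρ.isPositive.re_inner_nonneg_right _) htr.summable]
  have := htr.tsum_eq
  simp only [RCLike.re_to_complex, this]
  simp

/-! ### Transposition: annihilation on number states becomes raising on coefficients. -/

/-- The linear combination of ladder operators with coefficients `α` (annihilation) and `β`
(creation) on the finite linear combinations of number states. -/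
def ladderOp (α β : Fin d → ℂ) : ModeOp d := ∑ j, (α j • annihilate j + β j • create j)

theorem linearCombination_annihilate (j : Fin d) (u : (Fin d → ℕ) → ℂ) (v : FiniteFock d) :
    Finsupp.linearCombination ℂ u (annihilate j v) =
      Finsupp.linearCombination ℂ (raising j u) v := by
  induction v using Finsupp.induction_linear with
  | zero => simp
  | add f g hf hg => simp [hf, hg]
  | single n c =>
    simp only [annihilate, Finsupp.linearCombination_single, map_smul, raising_apply, smul_eq_mul]

theorem linearCombination_create (j : Fin d) (u : (Fin d → ℕ) → ℂ) (v : FiniteFock d) :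
    Finsupp.linearCombination ℂ u (create j v) =
      Finsupp.linearCombination ℂ (lowering j u) v := by
  induction v using Finsupp.induction_linear with
  | zero => simp
  | add f g hf hg => simp [hf, hg]
  | single n c =>
    simp only [create, Finsupp.linearCombination_single, map_smul, lowering_apply, smul_eq_mul]

theorem linearCombination_ladderOp (α β : Fin d → ℂ) (u : (Fin d → ℕ) → ℂ) (v : FiniteFock d) :
    Finsupp.linearCombination ℂ u (ladderOp α β v) =
      Finsupp.linearCombination ℂ (ladder β α u) v := by
  induction v using Finsupp.induction_linear with
  | zero => simp
  | add f g hf hg => simp [hf, hg]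
  | single n c =>
    simp only [ladderOp, LinearMap.sum_apply, LinearMap.add_apply, LinearMap.smul_apply, map_sum,
      map_add, map_smul, linearCombination_annihilate, linearCombination_create,
      Finsupp.linearCombination_single, ladder_apply, smul_eq_mul, Finset.mul_sum]
    exact Finset.sum_congr rfl fun j _ => by ring

theorem linearCombination_ladderOp_pow (α β : Fin d → ℂ) (m : ℕ) (u : (Fin d → ℕ) → ℂ)
    (n : Fin d → ℕ) : Finsupp.linearCombination ℂ u ((ladderOp α β ^ m) (Finsupp.single n 1)) =
      (ladder β α ^ m) u n := by
  induction m generalizing u with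
  | zero => simp
  | succ m ih =>
    rw [pow_succ', Module.End.mul_apply, linearCombination_ladderOp, ih, pow_succ,
      Module.End.mul_apply]

/-- Reading off a coefficient is pairing with a `Pi.single`, so the claim passes to the transposes.
-/
theorem commute_ladderOp {α β α' β' : Fin d → ℂ} (h : ∑ j, (α j * β' j - β j * α' j) = 0) :
    Commute (ladderOp α β) (ladderOp α' β') := by
  classical
  refine LinearMap.ext fun v => Finsupp.ext fun n => ?_
  have hn : ∀ w : FiniteFock d, w n = Finsupp.linearCombination ℂ (Pi.single n (1 : ℂ)) w :=
    fun w => by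
      simp [Finsupp.linearCombination_apply, Finsupp.sum, Pi.single_apply]
  have hc : Commute (ladder β α) (ladder β' α') := commute_ladder (by
    rw [← neg_eq_zero, ← Finset.sum_neg_distrib, ← h]
    exact Finset.sum_congr rfl fun j _ => by ring)
  rw [hn, hn, Module.End.mul_apply, Module.End.mul_apply, linearCombination_ladderOp,
    linearCombination_ladderOp, linearCombination_ladderOp, linearCombination_ladderOp,
    ← Module.End.mul_apply, ← Module.End.mul_apply, hc.eq]

theorem Splits.smul {G : Finset (Fin d)} {u : (Fin d → ℕ) → ℂ} (h : Splits G u) (c : ℂ) :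
    Splits G (c • u) := by
  obtain ⟨φ, χ, hφ, hχ, rfl⟩ := h
  exact ⟨c • φ, χ, fun x y hxy => by simp [hφ hxy], hχ, by rw [smul_mul_assoc]⟩

end Decompositions

/-! ### Separability as a product structure of the Gram vectors. -/

noncomputable section Separability

theorem Splits.of_comp {d k l : ℕ} {G : Finset (Fin d)} {f : Fin k → Fin d} {g : Fin l → Fin d}
    (hf : ∀ i, f i ∈ G) (hg : ∀ i, g i ∉ G) (u : (Fin k → ℕ) → ℂ) (v : (Fin l → ℕ) → ℂ) :
    Splits G fun n => u (n ∘ f) * v (n ∘ g) := by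
  refine ⟨fun n => u (n ∘ f), fun n => v (n ∘ g), fun x y hxy => ?_, fun x y hxy => ?_, rfl⟩
  · exact congrArg u (funext fun i => hxy _ (hf i))
  · exact congrArg v (funext fun i => hxy _ (hg i))

theorem isGram_of_partiallySeparable {s : Fin 3} {ρ : DensityOperator 3}
    (hρ : ρ ∈ PartiallySeparable s) : IsGram {u | Splits {s} u} ρ.elem := by
  refine IsMixture.isGram hρ (fun c u hu => hu.smul c) ?_
  rintro ρ' ⟨σ, τ, h⟩
  have hK := (σ.isGram.comp fun _ : Fin 1 => s).mul (τ.isGram.comp s.succAbove)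
  rw [show ρ'.elem = _ from funext₂ h]
  refine hK.mono ?_
  rintro _ ⟨_, ⟨u, -, rfl⟩, _, ⟨v, -, rfl⟩, rfl⟩
  exact Splits.of_comp (fun _ => by simp) (fun i => by simp) u v

theorem isGram_of_fullySeparable {ρ : DensityOperator 3} (hρ : ρ ∈ FullySeparable) :
    IsGram {u | ∀ s, Splits {s} u} ρ.elem := by
  refine IsMixture.isGram hρ (fun c u hu s => (hu s).smul c) ?_
  rintro ρ' ⟨σ, h⟩
  have hσ := fun i : Fin 3 => (σ i).isGram.comp fun _ : Fin 1 => i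
  have hK := ((hσ 0).mul (hσ 1)).mul (hσ 2)
  have hel : ρ'.elem = fun n m => (σ 0).elem (n ∘ fun _ => 0) (m ∘ fun _ => 0) *
      (σ 1).elem (n ∘ fun _ => 1) (m ∘ fun _ => 1) *
        (σ 2).elem (n ∘ fun _ => 2) (m ∘ fun _ => 2) := by
    ext n m
    rw [h, Fin.prod_univ_three]
    rfl
  rw [hel]
  refine hK.mono ?_
  rintro _ ⟨_, ⟨_, ⟨u, -, rfl⟩, _, ⟨v, -, rfl⟩, rfl⟩, _, ⟨w, -, rfl⟩, rfl⟩ s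
  have hprod : ((fun n : Fin 3 → ℕ => u (n ∘ fun _ => 0)) * fun n => v (n ∘ fun _ => 1)) *
      (fun n => w (n ∘ fun _ => 2)) = fun n => (![u, v, w] s) (n ∘ fun _ => s) *
        (fun x : Fin 2 → ℕ => ∏ i, ![u, v, w] (s.succAbove i) fun _ => x i) (n ∘ s.succAbove) := by
    ext n
    have := Fin.prod_univ_succAbove (fun i => ![u, v, w] i fun _ => n i) s
    rw [Fin.prod_univ_three] at this
    exact this
  rw [hprod]
  exact Splits.of_comp (G := {s}) (f := fun _ : Fin 1 => s) (g := s.succAbove) (fun _ => by simp)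
    (fun i => by simp) (![u, v, w] s)
    (fun x : Fin 2 → ℕ => ∏ i, ![u, v, w] (s.succAbove i) fun _ => x i)

theorem isGram_of_biseparable {ρ : DensityOperator 3} (hρ : ρ ∈ Biseparable) :
    IsGram {u | ∃ s, Splits {s} u} ρ.elem := by
  refine IsMixture.isGram hρ (fun c u ⟨s, hs⟩ => ⟨s, hs.smul c⟩) fun σ hσ => ?_
  obtain ⟨s, hs⟩ := Set.mem_iUnion.1 hσ
  exact (isGram_of_partiallySeparable hs).mono fun u hu => ⟨s, hu⟩

/-- Products of a function in `C` of the first three modes and a function of the last one. -/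
def augmentedClass (C : Set ((Fin 3 → ℕ) → ℂ)) : Set ((Fin 4 → ℕ) → ℂ) :=
  {w | ∃ u ∈ C, ∃ v : (Fin 1 → ℕ) → ℂ,
    w = fun n => u (n ∘ Fin.castSucc) * v (n ∘ fun _ => Fin.last 3)}

theorem isGram_of_augmented {S : Set (DensityOperator 3)} {C : Set ((Fin 3 → ℕ) → ℂ)}
    (hC : ∀ σ ∈ S, IsGram C σ.elem) {ρ : DensityOperator 4} (hρ : ρ ∈ Augmented S) :
    IsGram (augmentedClass C) ρ.elem := by
  refine IsMixture.isGram hρ ?_ ?_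
  · rintro c _ ⟨u, hu, v, rfl⟩
    refine ⟨u, hu, c • v, ?_⟩
    ext n
    simp only [Pi.smul_apply, smul_eq_mul]
    ring
  · rintro ρ' ⟨σ, hσ, τ, h⟩
    have hK := ((hC σ hσ).comp Fin.castSucc).mul (τ.isGram.comp fun _ : Fin 1 => Fin.last 3)
    rw [show ρ'.elem = _ from funext₂ h]
    refine hK.mono ?_
    rintro _ ⟨_, ⟨u, hu, rfl⟩, _, ⟨v, -, rfl⟩, rfl⟩
    exact ⟨u, hu, v, rfl⟩

theorem splits_last_of_mem_augmentedClass {C : Set ((Fin 3 → ℕ) → ℂ)} {w : (Fin 4 → ℕ) → ℂ}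
    (hw : w ∈ augmentedClass C) : Splits {Fin.last 3} w := by
  obtain ⟨u, -, v, rfl⟩ := hw
  have := Splits.of_comp (G := {Fin.last 3}) (f := fun _ : Fin 1 => Fin.last 3)
    (g := Fin.castSucc) (by simp)
    (fun i hi => Fin.castSucc_ne_last i (Finset.mem_singleton.1 hi)) v u
  simpa only [mul_comm] using this

/-- The factor of `z` is independent of the rest and may join either side of the cut. Joined to `s`,
its commutator adds with the same sign. -/
theorem splits_pair_of_splits {s : Fin 3} {u : (Fin 3 → ℕ) → ℂ} (hu : Splits {s} u)
    (v : (Fin 1 → ℕ) → ℂ) : Splits {s.castSucc, Fin.last 3}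
      fun n : Fin 4 → ℕ => u (n ∘ Fin.castSucc) * v (n ∘ fun _ => Fin.last 3) := by
  obtain ⟨φ, χ, hφ, hχ, rfl⟩ := hu
  refine ⟨fun n => φ (n ∘ Fin.castSucc) * v (n ∘ fun _ => Fin.last 3),
    fun n => χ (n ∘ Fin.castSucc), fun x y hxy => ?_, fun x y hxy => ?_, ?_⟩
  · simp only
    rw [hφ (x := x ∘ Fin.castSucc) (y := y ∘ Fin.castSucc) fun i hi => hxy _ (by
      simp at hi; simp [hi])]
    congr 2
    ext i
    exact hxy _ (by simp)
  · refine hχ fun i hi => hxy _ ?_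
    have his : i ≠ s := by simpa using hi
    simpa [his] using Fin.castSucc_ne_last i
  · ext n
    simp only [Pi.mul_apply]
    ring

end Separability

/-! ### The augmented observables and their constants. -/

noncomputable section AugmentedBounds

theorem two_mul_enorm_sq_add_enorm_sq (x y : ℂ) :
    2 * (‖x‖ₑ ^ 2 + ‖y‖ₑ ^ 2) = ‖x + Complex.I * y‖ₑ ^ 2 + ‖x - Complex.I * y‖ₑ ^ 2 := by
  have h := parallelogram_law_with_norm ℝ x (Complex.I * y)
  have hI : ‖Complex.I * y‖ = ‖y‖ := by simp
  rw [hI] at h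
  have h2 : (2 : ℝ≥0∞) = ENNReal.ofReal 2 := by simp
  simp only [← ofReal_norm]
  rw [h2, ← ENNReal.ofReal_pow (norm_nonneg _), ← ENNReal.ofReal_pow (norm_nonneg _),
    ← ENNReal.ofReal_pow (norm_nonneg _), ← ENNReal.ofReal_pow (norm_nonneg _),
    ← ENNReal.ofReal_add (by positivity) (by positivity),
    ← ENNReal.ofReal_add (by positivity) (by positivity), ← ENNReal.ofReal_mul (by norm_num)]
  congr 1
  linarith

variable {d : ℕ}

/-- The sum of the momenta with coefficients `ε`, together with the sum of the positions, has the
two combinations of ladder operators with coefficients `(1 ± ε) / √2` as complex combinations. -/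
theorem two_mul_tsum_position_add_momentum (ε : Fin d → ℂ) (c : ℂ) (u : (Fin d → ℕ) → ℂ) :
    2 * (∑' n, ‖ladder (fun _ => c) (fun _ => c) u n‖ₑ ^ 2 +
        ∑' n, ‖ladder (fun j => Complex.I * c * ε j) (fun j => -Complex.I * c * ε j) u n‖ₑ ^ 2) =
      ∑' n, ‖ladder (fun j => c * (1 - ε j)) (fun j => c * (1 + ε j)) u n‖ₑ ^ 2 +
        ∑' n, ‖ladder (fun j => c * (1 + ε j)) (fun j => c * (1 - ε j)) u n‖ₑ ^ 2 := by
  rw [← ENNReal.tsum_add, ← ENNReal.tsum_add, ← ENNReal.tsum_mul_left]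
  refine tsum_congr fun n => ?_
  rw [two_mul_enorm_sq_add_enorm_sq]
  congr 3
  · simp only [ladder_apply, Finset.mul_sum, ← Finset.sum_add_distrib]
    refine Finset.sum_congr rfl fun j _ => ?_
    linear_combination (c * ε j * lowering j u n - c * ε j * raising j u n) * Complex.I_sq
  · simp only [ladder_apply, Finset.mul_sum, ← Finset.sum_sub_distrib]
    refine Finset.sum_congr rfl fun j _ => ?_
    linear_combination -(c * ε j * lowering j u n - c * ε j * raising j u n) * Complex.I_sq

/-- The signs of the momenta in the observable that belongs to the part `s`. -/
def momentumSign (s : Fin 3) : Fin 4 → ℂ :=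
  ![![1, -1, -1, 1], ![-1, 1, -1, 1], ![-1, -1, 1, 1]] s

/-- The common coefficient `1 / √2` of the ladder operators in the quadratures. -/
def quadratureCoeff : ℂ := ((√2 : ℝ) : ℂ)⁻¹

theorem norm_quadratureCoeff_mul_sq (x : ℂ) : ‖quadratureCoeff * x‖ ^ 2 = ‖x‖ ^ 2 / 2 := by
  rw [norm_mul, mul_pow, quadratureCoeff, norm_inv, Complex.norm_real,
    Real.norm_of_nonneg (Real.sqrt_nonneg _), inv_pow, Real.sq_sqrt (by norm_num)]
  ring

theorem augmentedObservable_zero : augmentedObservable 0 =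
    ladderOp (fun _ => quadratureCoeff) (fun _ => quadratureCoeff) := by
  simp only [augmentedObservable, Matrix.cons_val_zero, ladderOp, Fin.sum_univ_four, position,
    quadratureCoeff]
  module

theorem augmentedObservable_succ (s : Fin 3) : augmentedObservable s.succ =
    ladderOp (fun j => -Complex.I * quadratureCoeff * momentumSign s j)
      (fun j => Complex.I * quadratureCoeff * momentumSign s j) := by
  fin_cases s <;>
  · simp [augmentedObservable, ladderOp, Fin.sum_univ_four, momentum, quadratureCoeff,
      momentumSign]
    module

theorem commute_augmentedObservable (i j : Fin 4) :
    Commute (augmentedObservable i) (augmentedObservable j) := by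
  have h0 : ∀ s : Fin 3, Commute (augmentedObservable 0) (augmentedObservable s.succ) := fun s => by
    rw [augmentedObservable_zero, augmentedObservable_succ]
    refine commute_ladderOp ?_
    fin_cases s <;> simp [Fin.sum_univ_four, momentumSign]
    all_goals ring
  cases i using Fin.cases with
  | zero =>
    cases j using Fin.cases with
    | zero => exact Commute.refl _
    | succ t => exact h0 t
  | succ s =>
    cases j using Fin.cases with
    | zero => exact (h0 s).symm
    | succ t =>
      rw [augmentedObservable_succ, augmentedObservable_succ]
      exact commute_ladderOp (Finset.sum_eq_zero fun j _ => by ring)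

/-- The second moment of `M` in the (unnormalized) pure state with coefficients `conj u`. -/
def pureMean (M : ModeOp d) (u : (Fin d → ℕ) → ℂ) : ℝ≥0∞ :=
  ∑' n, ‖Finsupp.linearCombination ℂ u (M (Finsupp.single n 1))‖ₑ ^ 2

theorem pureMean_ladderOp_pow (α β : Fin d → ℂ) (m : ℕ) (u : (Fin d → ℕ) → ℂ) :
    pureMean (ladderOp α β ^ m) u = ∑' n, ‖(ladder β α ^ m) u n‖ₑ ^ 2 := by
  simp only [pureMean, linearCombination_ladderOp_pow]

theorem pureMean_ladderOp (α β : Fin d → ℂ) (u : (Fin d → ℕ) → ℂ) :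
    pureMean (ladderOp α β) u = ∑' n, ‖ladder β α u n‖ₑ ^ 2 := by
  simpa using pureMean_ladderOp_pow α β 1 u

/-- `X + i P_s` is bounded through `G` and `X - i P_s`, with opposite commutator, through the
complement. Since the signs of the momenta add up to zero, both sides can give the same `κ`. -/
theorem position_add_momentum_ge {s : Fin 3} {G : Finset (Fin 4)} {κ : ℝ} (h0 : 0 < κ)
    (h₁ : ∑ j ∈ G, ((‖1 + momentumSign s j‖ ^ 2 - ‖1 - momentumSign s j‖ ^ 2) / 2) = κ)
    (h₂ : ∑ j ∈ Gᶜ, ((‖1 - momentumSign s j‖ ^ 2 - ‖1 + momentumSign s j‖ ^ 2) / 2) = κ)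
    {u : (Fin 4 → ℕ) → ℂ} (hu : Splits G u) (hfin : ∑' n, ‖u n‖ₑ ^ 2 ≠ ∞) :
    ENNReal.ofReal κ * ∑' n, ‖u n‖ₑ ^ 2 ≤
      pureMean (augmentedObservable 0) u + pureMean (augmentedObservable s.succ) u := by
  rw [augmentedObservable_zero, augmentedObservable_succ, pureMean_ladderOp, pureMean_ladderOp]
  have hp := two_mul_tsum_position_add_momentum (momentumSign s) quadratureCoeff u
  have k₁ := hu.tsum_ladder_pow_ge (α := fun j => quadratureCoeff * (1 - momentumSign s j))
    (β := fun j => quadratureCoeff * (1 + momentumSign s j)) (κ := κ)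
    (by simpa only [norm_quadratureCoeff_mul_sq, ← sub_div] using h₁) h0 hfin 1
  have k₂ := hu.compl.tsum_ladder_pow_ge (α := fun j => quadratureCoeff * (1 + momentumSign s j))
    (β := fun j => quadratureCoeff * (1 - momentumSign s j)) (κ := κ)
    (by simpa only [norm_quadratureCoeff_mul_sq, ← sub_div] using h₂) h0 hfin 1
  simp only [Nat.factorial_one, Nat.cast_one, pow_one, one_mul] at k₁ k₂
  rw [← ENNReal.mul_le_mul_iff_right (a := 2) (by norm_num) (by norm_num), hp, two_mul]
  exact add_le_add k₁ k₂

theorem succAbove_two_one : Fin.succAbove (2 : Fin 3) (1 : Fin 2) = 1 := rfl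

theorem compl_pair_castSucc_last : ∀ s : Fin 3, ({s.castSucc, Fin.last 3}ᶜ : Finset (Fin 4)) =
    {(s.succAbove 0).castSucc, (s.succAbove 1).castSucc} := by
  decide

theorem position_add_momentum_ge_two {u : (Fin 4 → ℕ) → ℂ} (hu : Splits {Fin.last 3} u)
    (hfin : ∑' n, ‖u n‖ₑ ^ 2 ≠ ∞) (s : Fin 3) : 2 * ∑' n, ‖u n‖ₑ ^ 2 ≤
      pureMean (augmentedObservable 0) u + pureMean (augmentedObservable s.succ) u := by
  have hc : ({Fin.last 3}ᶜ : Finset (Fin 4)) = {0, 1, 2} := by decide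
  have := position_add_momentum_ge (s := s) (κ := 2) (by norm_num) ?_ ?_ hu hfin
  · simpa using this
  -- A mode with sign `ε` contributes `2ε`: the mode `z` gives 2, and the others, with signs summing
  -- to -1, give 2 for the opposite operator.
  · fin_cases s <;> simp [momentumSign] <;> norm_num
  · rw [hc]
    fin_cases s <;> simp [momentumSign] <;> norm_num

theorem position_add_momentum_ge_four {s : Fin 3} {u : (Fin 4 → ℕ) → ℂ}
    (hu : Splits {s.castSucc, Fin.last 3} u) (hfin : ∑' n, ‖u n‖ₑ ^ 2 ≠ ∞) :
    4 * ∑' n, ‖u n‖ₑ ^ 2 ≤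
      pureMean (augmentedObservable 0) u + pureMean (augmentedObservable s.succ) u := by
  have := position_add_momentum_ge (s := s) (κ := 4) (by norm_num) ?_ ?_ hu hfin
  · simpa using this
  · rw [Finset.sum_pair (Fin.castSucc_ne_last s)]
    fin_cases s <;> simp [momentumSign] <;> norm_num
  · rw [compl_pair_castSucc_last]
    fin_cases s <;> simp [momentumSign, succAbove_two_one] <;> norm_num

/-- The weight 3 hands one copy of the position moment to each `s`. The weights `b` may depend on
the vector, as different vectors of a biseparable state split along different cuts. -/
theorem augmentedT_ge {C : Set ((Fin 4 → ℕ) → ℂ)} {ρ : DensityOperator 4} (h : IsGram C ρ.elem)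
    {b : Fin 3 → ((Fin 4 → ℕ) → ℂ) → ℝ≥0∞} {c : ℝ≥0∞} (hb : ∀ u ∈ C, ∑ s, b s u = c)
    (hC : ∀ u ∈ C, ∑' n, ‖u n‖ₑ ^ 2 ≠ ∞ → ∀ s : Fin 3, b s u * ∑' n, ‖u n‖ₑ ^ 2 ≤
      pureMean (augmentedObservable 0) u + pureMean (augmentedObservable s.succ) u) :
    c ≤ augmentedT ρ := by
  obtain ⟨ι, u, hu, h1, hmean⟩ := h.exists_mean_eq_tsum
  have hfin : ∀ k, ∑' n, ‖u k n‖ₑ ^ 2 ≠ ∞ := fun k =>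
    ne_top_of_le_ne_top (by simp [h1]) (ENNReal.le_tsum (f := fun k => ∑' n, ‖u k n‖ₑ ^ 2) k)
  have hT : augmentedT ρ = ∑' k, ∑ s : Fin 3,
      (pureMean (augmentedObservable 0) (u k) + pureMean (augmentedObservable s.succ) (u k)) := by
    simp only [augmentedT, hmean, Fin.sum_univ_three, ← ENNReal.tsum_mul_left, ← ENNReal.tsum_add]
    refine tsum_congr fun k => ?_
    simp only [pureMean, ENNReal.tsum_add, ENNReal.tsum_mul_left]
    simp only [show (Fin.succ 0 : Fin 4) = 1 from rfl, show (Fin.succ 1 : Fin 4) = 2 from rfl,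
      show (Fin.succ 2 : Fin 4) = 3 from rfl]
    ring
  rw [hT, ← mul_one c, ← h1, ← ENNReal.tsum_mul_left]
  refine ENNReal.tsum_le_tsum fun k => ?_
  rw [← hb _ (hu k), Finset.sum_mul]
  exact Finset.sum_le_sum fun s _ => hC _ (hu k) (hfin k) s

/-- The coefficients of the creation operators in the combination that belongs to the part `s`. -/
def creationCoeff (s : Fin 3) : Fin 4 → ℂ := ![![1, 0, 0, 1], ![0, 1, 0, 1], ![0, 0, 1, 1]] s

theorem augmentedA_eq (m : ℕ) (s : Fin 3) (ρ : DensityOperator 4) :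
    augmentedA m s ρ = (m.factorial : ℝ≥0∞)⁻¹ * meanMulAdjoint ρ
      (ladderOp (fun j => 1 - creationCoeff s j) (creationCoeff s) ^ m) := by
  rw [augmentedA]
  congr 3
  fin_cases s <;> simp [ladderOp, Fin.sum_univ_four, creationCoeff, succAbove_two_one] <;> abel

/-- The complement of `G` is used because transposition turns the annihilation operators of the
modes other than `s` and `z` into raising operators, which contribute positively to the commutator.
-/
theorem augmentedA_ge {C : Set ((Fin 4 → ℕ) → ℂ)} {ρ : DensityOperator 4} (h : IsGram C ρ.elem)
    {G : Finset (Fin 4)} (hC : ∀ u ∈ C, Splits G u) {s : Fin 3} {κ : ℕ} (h0 : 0 < κ)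
    (hκ : ∑ j ∈ Gᶜ, (‖1 - creationCoeff s j‖ ^ 2 - ‖creationCoeff s j‖ ^ 2) = κ) (m : ℕ) :
    (κ : ℝ≥0∞) ^ m ≤ augmentedA m s ρ := by
  obtain ⟨ι, u, hu, h1, hmean⟩ := h.exists_mean_eq_tsum
  have hfin : ∀ k, ∑' n, ‖u k n‖ₑ ^ 2 ≠ ∞ := fun k =>
    ne_top_of_le_ne_top (by simp [h1]) (ENNReal.le_tsum (f := fun k => ∑' n, ‖u k n‖ₑ ^ 2) k)
  have hge : (m.factorial : ℝ≥0∞) * (κ : ℝ≥0∞) ^ m ≤ meanMulAdjoint ρ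
      (ladderOp (fun j => 1 - creationCoeff s j) (creationCoeff s) ^ m) := by
    rw [hmean, ← mul_one ((m.factorial : ℝ≥0∞) * _), ← h1, ← ENNReal.tsum_mul_left]
    refine ENNReal.tsum_le_tsum fun k => ?_
    have := (hC _ (hu k)).compl.tsum_ladder_pow_ge (α := creationCoeff s)
      (β := fun j => 1 - creationCoeff s j) hκ (by exact_mod_cast h0) (hfin k) m
    rw [← pureMean_ladderOp_pow] at this
    refine le_trans (le_of_eq ?_) this
    rw [ENNReal.ofReal_mul (by positivity), ENNReal.ofReal_pow (by positivity),
      ENNReal.ofReal_natCast, ENNReal.ofReal_natCast]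
  rw [augmentedA_eq]
  calc (κ : ℝ≥0∞) ^ m = (m.factorial : ℝ≥0∞)⁻¹ * (m.factorial * (κ : ℝ≥0∞) ^ m) := by
        rw [← mul_assoc, ENNReal.inv_mul_cancel (by exact_mod_cast m.factorial_ne_zero)
          (ENNReal.natCast_ne_top _), one_mul]
    _ ≤ _ := by gcongr

end AugmentedBounds

/-! ### Assembly of the bounds. -/

theorem mainTheorem6 :
    -- the bounds on `T' - 3`
    (∀ ρ ∈ Augmented FullySeparable, 9 ≤ augmentedT ρ - 3) ∧
    (∀ ρ ∈ Augmented Biseparable, 5 ≤ augmentedT ρ - 3) ∧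
    (∀ ρ ∈ Augmented Set.univ, 3 ≤ augmentedT ρ - 3) ∧
    -- the observables that enter `T'` commute
    (∀ i j : Fin 4, Commute (augmentedObservable i) (augmentedObservable j)) ∧
    -- the bounds on the augmented quantities of all orders
    (∀ (m : ℕ) (s : Fin 3), ∀ ρ ∈ Augmented (PartiallySeparable s), 2 ^ m ≤ augmentedA m s ρ) ∧
    (∀ (m : ℕ) (s : Fin 3), ∀ ρ ∈ Augmented Set.univ, 1 ≤ augmentedA m s ρ) := by
  refine ⟨fun ρ hρ => ?_, fun ρ hρ => ?_, fun ρ hρ => ?_, commute_augmentedObservable,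
    fun m s ρ hρ => ?_, fun m s ρ hρ => ?_⟩
  · have h := isGram_of_augmented (fun _ => isGram_of_fullySeparable) hρ
    refine ENNReal.le_sub_of_add_le_right (by norm_num) ?_
    refine augmentedT_ge h (b := fun _ _ => 4) (fun u _ => by norm_num) ?_
    rintro _ ⟨u, hu, v, rfl⟩ hfin s
    exact position_add_momentum_ge_four (splits_pair_of_splits (hu s) v) hfin
  · classical
    have h := isGram_of_augmented (fun _ => isGram_of_biseparable) hρ
    refine ENNReal.le_sub_of_add_le_right (by norm_num) ?_
    have hex : ∀ w : (Fin 4 → ℕ) → ℂ, ∃ t : Fin 3, w ∈ augmentedClass {u | ∃ s, Splits {s} u} →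
        Splits {t.castSucc, Fin.last 3} w := fun w => by
      by_cases hw : w ∈ augmentedClass {u | ∃ s, Splits {s} u}
      · obtain ⟨u, ⟨t, ht⟩, v, rfl⟩ := hw
        exact ⟨t, fun _ => splits_pair_of_splits ht v⟩
      · exact ⟨0, fun h => absurd h hw⟩
    choose t ht using hex
    -- The cut along which `w` splits gives 4 and the other two give the unconditional 2: in total 8
    -- = 5 + 3.
    refine augmentedT_ge h (b := fun s w => if s = t w then 4 else 2) (fun u _ => ?_) ?_
    · generalize t u = r
      fin_cases r <;> simp [Fin.sum_univ_three] <;> norm_num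
    · intro w hw hfin s
      split_ifs with hs
      · exact position_add_momentum_ge_four (hs ▸ ht w hw) hfin
      · exact position_add_momentum_ge_two (splits_last_of_mem_augmentedClass hw) hfin s
  · have h := isGram_of_augmented (fun σ _ => σ.isGram) hρ
    refine ENNReal.le_sub_of_add_le_right (by norm_num) ?_
    refine augmentedT_ge h (b := fun _ _ => 2) (fun u _ => by norm_num) fun w hw hfin s => ?_
    exact position_add_momentum_ge_two (splits_last_of_mem_augmentedClass hw) hfin s
  · have h := isGram_of_augmented (fun _ => isGram_of_partiallySeparable) hρ
    have := augmentedA_ge h (G := {s.castSucc, Fin.last 3}) (s := s) (κ := 2) ?_ (by norm_num) ?_ m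
    · exact_mod_cast this
    · rintro _ ⟨u, hu, v, rfl⟩
      exact splits_pair_of_splits hu v
    · rw [compl_pair_castSucc_last]
      fin_cases s <;> simp [creationCoeff, succAbove_two_one] <;> norm_num
  · have h := isGram_of_augmented (fun σ _ => σ.isGram) hρ
    have := augmentedA_ge h (G := {Fin.last 3}) (s := s) (κ := 1)
      (fun w hw => splits_last_of_mem_augmentedClass hw) (by norm_num) ?_ m
    · simpa using this
    · have hc : ({Fin.last 3}ᶜ : Finset (Fin 4)) = {0, 1, 2} := by decide
      rw [hc]
      -- Two raising modes and one lowering mode among `a, b, c`: `1 + 1 - 1 = 1`.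
      fin_cases s <;> simp [creationCoeff]
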